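/- Let $d\in\{2,3\}$, let $\Omega\subset\mathbb R^d$ be a convex polygonal/polyhedral domain with a conforming simplicial mesh $\mathcal T$ of mesh size $h$ (largest element diameter), and let $\Sigma\subset\partial\Omega$ be a nonempty union of boundary faces of $\mathcal T$ that does not contain all boundary faces. Let $A\in\mathbb R^{d\times d}$ be symmetric positive definite, $\mu\in\mathbb R$, $\gamma_T>0$, $k\ge 1$ and $l\in\{k-1,k\}$. Let $f\in L^2(\Omega)$, $g\in C(\Sigma)$, $\psi\in L^2(\Sigma)$; let $g_h$ be the nodal interpolant of $g$ on $\Sigma$ of order $k$ and $\psi_h$ the facewise $L^2$-projection of $\psi$ onto polynomials of degree $\le l$. Let $X_h^k$ be the space of piecewise polynomials of degree $\le k$ on $\mathcal T$, $V_g^k=\{v\in X_h^k\cap H^1(\Omega): v=g_h \text{ on }\Sigma\}$, $D_\psi^l=\{q\in RT^l: q\cdot\nu=\psi_h\text{ on }\Sigma\}$, where $RT^l$ is the $H(\mathrm{div};\Omega)$-conforming Raviart–Thomas space of order $l$ and $\nu$ the outward unit normal, let $V_0^k$, $D_0^l$ be the same spaces with $g_h=0$, $\psi_h=0$, and $W^l=X_h^l$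 with $L^2$-projection $\pi_W$. Let $$b(q,v,y)=(\nabla\cdot q+\mu v,y)_\Omega,\qquad s^*(z,w)=\tfrac12(z,w)_\Omega,$$ $$s[(u,p),(v,q)]=\tfrac12(A\nabla u-p,A\nabla v-q)_\Omega+t(u,v),$$ where $t$ is either of the symmetric bilinear forms with quadratic forms $$t(v,v)=\tfrac12\gamma_Th^{2k}\|\nabla v\|_\Omega^2\quad\text{or}\quad t(v,v)=\tfrac12\mu^2h^2\|(1-\pi_W)v\|_\Omega^2+\gamma_Th^{2k}\|\nabla v\|_\Omega^2 .$$ Then: 1. The primal-dual system with zero dual stabilizer, to find $(u_h,p_h,z_h)\in V_g^k\times D_\psi^l\times W^l$ with $$s[(u_h,p_h),(v,q)]+b(q,v,z_h)=0,\qquad b(p_h,u_h,w)=(f,w)_\Omega$$ for all $(v,q,w)\in V_0^k\times D_0^l\times W^l$, has exactly one solution. 2. For every $z^\kappa\in W^l$ there is exactly one $(u^{\kappa+1},p^{\kappa+1},z^{\kappa+1})\in V_g^k\times D_\psi^l\times W^l$ with $$s[(u^{\kappa+1},p^{\kappa+1}),(v,q)]+b(q,v,z^{\kappa+1})=0,$$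 $$b(p^{\kappa+1},u^{\kappa+1},w)-s^*(z^{\kappa+1},w)=(f,w)_\Omega-s^*(z^\kappa,w)$$ for all $(v,q,w)\in V_0^k\times D_0^l\times W^l$. 3. The iterates of the scheme in 2, started from $z^0=0$, satisfy, as $\kappa\to\infty$, $u^\kappa\to u_h$ in $H^1(\Omega)$, $p^\kappa\to p_h$ in $H(\mathrm{div};\Omega)$ and $z^\kappa\to z_h$ in $L^2(\Omega)$. -/

import Mathlib

open MeasureTheory Filter Topology

noncomputable section

namespace CauchyFEM

/-- Points of `ℝ^d`. -/
abbrev Pt (d : ℕ) := EuclideanSpace ℝ (Fin d)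

/-- The value of a polynomial in `d` variables at a point of `ℝ^d`. -/
def evalAt {d : ℕ} (p : MvPolynomial (Fin d) ℝ) (x : Pt d) : ℝ :=
  MvPolynomial.eval (fun i => x i) p

/-- A conforming simplicial mesh of `Ω ⊆ ℝ^d`: a finite simplicial complex all of whose simplices
are faces of `d`-dimensional simplices and which covers exactly `closure Ω`. Conformity (two
simplices meet in a common face or not at all) is part of `Geometry.SimplicialComplex`. -/
structure Mesh {d : ℕ} (Ω : Set (Pt d)) extends Geometry.SimplicialComplex ℝ (Pt d) where
  finite_faces : faces.Finite
  pure : ∀ s ∈ faces, ∃ K ∈ faces, K.card = d + 1 ∧ s ⊆ K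
  space_eq : toSimplicialComplex.space = closure Ω

namespace Mesh

variable {d : ℕ} {Ω : Set (Pt d)} (T : Mesh Ω)

/-- The elements `K` of the mesh, given by their vertex sets: the `d`-dimensional simplices. -/
def Element : Type := {K : Finset (Pt d) // K ∈ T.faces ∧ K.card = d + 1}

instance instFiniteElement : Finite T.Element :=
  (T.finite_faces.subset (fun _ hK => hK.1 :
    {K : Finset (Pt d) | K ∈ T.faces ∧ K.card = d + 1} ⊆ T.faces)).to_subtype

instance instFintypeElement : Fintype T.Element := Fintype.ofFinite _

variable {T}

/-- The closed simplex in `ℝ^d` occupied by an element. -/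
def Element.hull (K : T.Element) : Set (Pt d) := convexHull ℝ (K.1 : Set (Pt d))

variable (T)

/-- The `(d-1)`-dimensional faces of the mesh that lie in the set `S`. -/
def facesIn (S : Set (Pt d)) : Set (Finset (Pt d)) :=
  {F | F ∈ T.faces ∧ F.card = d ∧ convexHull ℝ (F : Set (Pt d)) ⊆ S}

/-- `S` is resolved by the mesh: it is a union of `(d-1)`-dimensional mesh faces. -/
def Fits (S : Set (Pt d)) : Prop :=
  S = ⋃ F ∈ T.facesIn S, convexHull ℝ (F : Set (Pt d))

/-- The mesh parameter `h`, the largest diameter of an element. -/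
def meshSize : ℝ := ⨆ K : T.Element, Metric.diam K.hull

/-- Scalar piecewise polynomials on the mesh. Such a function is determined, as an element of
`L²(Ω)`, by the family of its polynomials on the elements, and every family arises. -/
abbrev Scalar := T.Element → MvPolynomial (Fin d) ℝ

/-- Vector valued piecewise polynomials on the mesh. -/
abbrev VField := T.Element → Fin d → MvPolynomial (Fin d) ℝ

variable {T}

/-- The elementwise gradient. -/
def grad (v : T.Scalar) : T.VField := fun K i => MvPolynomial.pderiv i (v K)

/-- The elementwise divergence. -/
def div (q : T.VField) : T.Scalar := fun K => ∑ i, MvPolynomial.pderiv i (q K i)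

/-- Multiplication of a vector field by a constant matrix. -/
def matMul (A : Matrix (Fin d) (Fin d) ℝ) (q : T.VField) : T.VField :=
  fun K i => ∑ j, A i j • q K j

/-- The scalar product `(v, w)_Ω`, summed over the elements. -/
def l2 (v w : T.Scalar) : ℝ := ∑ K : T.Element, ∫ x in K.hull, evalAt (v K) x * evalAt (w K) x

/-- The scalar product `(p, q)_Ω` of vector fields. -/
def l2v (p q : T.VField) : ℝ :=
  ∑ K : T.Element, ∫ x in K.hull, ∑ i, evalAt (p K i) x * evalAt (q K i) x

/-- The pairing `(f, w)_Ω` of a function with a piecewise polynomial. -/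
def load (f : Pt d → ℝ) (w : T.Scalar) : ℝ :=
  ∑ K : T.Element, ∫ x in K.hull, f x * evalAt (w K) x

/-- The `L²(Ω)` norm. -/
def normL2 (v : T.Scalar) : ℝ := √(l2 v v)

/-- The `H¹(Ω)` norm. -/
def normH1 (v : T.Scalar) : ℝ := √(l2 v v + l2v (grad v) (grad v))

/-- The `H(div; Ω)` norm. -/
def normHdiv (q : T.VField) : ℝ := √(l2v q q + l2 (div q) (div q))

variable (T)

/-- `X_h^k = W^k`: piecewise polynomials of degree at most `k`. -/
def X (k : ℕ) : Set T.Scalar := {v | ∀ K, (v K).totalDegree ≤ k}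

/-- The `H¹`-conforming Lagrange space `L_h^k = H¹(Ω) ∩ X_h^k`; for a piecewise polynomial, to be
in `H¹(Ω)` is to be continuous, i.e. single valued on intersections of elements. -/
def lagrange (k : ℕ) : Set T.Scalar :=
  {v | v ∈ T.X k ∧ ∀ K K' : T.Element, ∀ x ∈ K.hull ∩ K'.hull, evalAt (v K) x = evalAt (v K') x}

/-- The piecewise polynomial `v` has the boundary values `b` on `S`. -/
def HasTrace (S : Set (Pt d)) (v : T.Scalar) (b : Pt d → ℝ) : Prop :=
  ∀ F ∈ T.facesIn S, ∀ K : T.Element, F ⊆ K.1 →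
    ∀ x ∈ convexHull ℝ (F : Set (Pt d)), evalAt (v K) x = b x

/-- The space of functions of `L_h^k` with the values `b` on `S`. It is `V_g^k` for `b = g_h` and
`V_0^k` for `b = 0`. -/
def V (k : ℕ) (S : Set (Pt d)) (b : Pt d → ℝ) : Set T.Scalar :=
  {v | v ∈ T.lagrange k ∧ T.HasTrace S v b}

/-- The Lagrange nodes of order `k` (principal lattice) of the simplex with vertex set `F`. -/
def nodes (k : ℕ) (F : Finset (Pt d)) : Set (Pt d) :=
  {x | ∃ a : Pt d → ℕ, ∑ v ∈ F, a v = k ∧ x = ∑ v ∈ F, ((a v : ℝ) / k) • v}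

/-- `gh` is the nodal interpolant of `g` on `S`: a trace on `S` of a function of `L_h^k` that agrees
with `g` at all Lagrange nodes of order `k` on `S`. -/
def IsNodalInterpolant (k : ℕ) (S : Set (Pt d)) (g gh : Pt d → ℝ) : Prop :=
  (∃ G ∈ T.lagrange k, T.HasTrace S G gh) ∧
    ∀ F ∈ T.facesIn S, ∀ x ∈ nodes k F, gh x = g x

/-- `n` is orthogonal to the face with vertex set `F`. -/
def IsNormalTo (F : Finset (Pt d)) (n : Pt d) : Prop :=
  ∀ a ∈ F, ∀ b ∈ F, inner ℝ (a - b) n = 0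

/-- `ν` is the outward unit normal of the convex set `Ω` on the boundary face `F`. -/
def IsOuterUnitNormal (Ω : Set (Pt d)) (F : Finset (Pt d)) (ν : Pt d) : Prop :=
  ‖ν‖ = 1 ∧ ∀ x ∈ convexHull ℝ (F : Set (Pt d)), ∀ y ∈ Ω, inner ℝ (y - x) ν ≤ 0

/-- The component along `n` of a polynomial vector field, at the point `x`. -/
def comp (q : Fin d → MvPolynomial (Fin d) ℝ) (n x : Pt d) : ℝ := ∑ i, evalAt (q i) x * n i

/-- The Raviart-Thomas space `RT^l`: vector fields which on each element belong to
`ℙ_l(K)^d + x ℙ_l(K)` and which are in `H(div; Ω)`; for a piecewise polynomial field the latter is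
continuity of the normal component across each face shared by two elements. -/
def RT (l : ℕ) : Set T.VField :=
  {q | (∀ K, ∃ s : MvPolynomial (Fin d) ℝ, s.totalDegree ≤ l ∧
          ∀ i, (q K i - MvPolynomial.X i * s).totalDegree ≤ l) ∧
       ∀ K K' : T.Element, ∀ F : Finset (Pt d), F.card = d → F ⊆ K.1 → F ⊆ K'.1 →
          ∀ n, IsNormalTo F n → ∀ x ∈ convexHull ℝ (F : Set (Pt d)),
            comp (q K) n x = comp (q K') n x}

/-- The fields of `RT^l` with normal component on the faces in `S` given by the polynomials `c`.
It is `D_ψ^l` for `c = ψ_h` and `D_0^l` for `c = 0`. -/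
def D (l : ℕ) (S : Set (Pt d)) (c : Finset (Pt d) → MvPolynomial (Fin d) ℝ) : Set T.VField :=
  {q | q ∈ T.RT l ∧ ∀ F ∈ T.facesIn S, ∀ K : T.Element, F ⊆ K.1 →
      ∀ ν, IsOuterUnitNormal Ω F ν →
        ∀ x ∈ convexHull ℝ (F : Set (Pt d)), comp (q K) ν x = evalAt (c F) x}

/-- `ψh` is the facewise `L²`-projection of `ψ`: on each face `F ⊆ S` it is the polynomial
`π_{F,l} ψ` of degree at most `l`, determined by `⟨ψ - π_{F,l} ψ, r⟩_F = 0` for all `r ∈ ℙ_l(F)`.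
Only the restriction of `ψh F` to the face `F` matters. -/
def IsFaceProjection (l : ℕ) (S : Set (Pt d)) (ψ : Pt d → ℝ)
    (ψh : Finset (Pt d) → MvPolynomial (Fin d) ℝ) : Prop :=
  ∀ F ∈ T.facesIn S, (ψh F).totalDegree ≤ l ∧
    ∀ r : MvPolynomial (Fin d) ℝ, r.totalDegree ≤ l →
      ∫ x in convexHull ℝ (F : Set (Pt d)), (ψ x - evalAt (ψh F) x) * evalAt r x ∂μHE[d - 1] = 0

/-- The `L²(Ω)`-projection onto `W^m`. -/
def piW (m : ℕ) (v : T.Scalar) : T.Scalar :=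
  Classical.epsilon fun w => w ∈ T.X m ∧ ∀ y ∈ T.X m, l2 (v - w) y = 0

/-- The two Tikhonov terms: the one of the reduced least squares method, and the one of the
primal-dual method, which also contains a projection error. -/
inductive Tikhonov
  | reduced
  | primalDual

/-- The bilinear form of the Tikhonov term. For `reduced` its quadratic form is
`½ γ h^{2k} ‖∇v‖²`, for `primalDual` it is `½ μ² h² ‖(1 - π_W) v‖² + γ h^{2k} ‖∇v‖²`. -/
def tForm (μ γ : ℝ) (k m : ℕ) : Tikhonov → T.Scalar → T.Scalar → ℝ
  | .reduced, u, v => 1 / 2 * γ * T.meshSize ^ (2 * k) * l2v (grad u) (grad v)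
  | .primalDual, u, v =>
      1 / 2 * μ ^ 2 * T.meshSize ^ 2 * l2 (u - T.piW m u) (v - T.piW m v)
        + γ * T.meshSize ^ (2 * k) * l2v (grad u) (grad v)

/-- The primal stabilizer `s[(u, p), (v, q)]`, the bilinear form with quadratic form
`½ ‖A ∇v - q‖² + t(v, v)`. -/
def sForm (A : Matrix (Fin d) (Fin d) ℝ) (t : T.Scalar → T.Scalar → ℝ)
    (u : T.Scalar) (p : T.VField) (v : T.Scalar) (q : T.VField) : ℝ :=
  1 / 2 * l2v (matMul A (grad u) - p) (matMul A (grad v) - q) + t u v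

/-- `b(q, v, y) = (∇ · q + μ v, y)_Ω`. -/
def bForm (μ : ℝ) (q : T.VField) (v y : T.Scalar) : ℝ := l2 (div q + μ • v) y

/-- The `L²` dual stabilizer, the bilinear form with quadratic form `½ ‖y‖²`. -/
def sStarL2 (z w : T.Scalar) : ℝ := 1 / 2 * l2 z w

/-- `x = (u, p, z) ∈ V_g^k × D_ψ^l × W^m` solves the Euler-Lagrange system
`s[(u, p), (v, q)] + b(q, v, z) = 0`, `b(p, u, w) - s*(z, w) = R(w)` for all
`(v, q, w) ∈ V_0^k × D_0^l × W^m`. -/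
def Solves (k l m : ℕ) (S : Set (Pt d)) (gh : Pt d → ℝ)
    (ψh : Finset (Pt d) → MvPolynomial (Fin d) ℝ) (μ : ℝ)
    (s : T.Scalar → T.VField → T.Scalar → T.VField → ℝ)
    (sStar : T.Scalar → T.Scalar → ℝ) (R : T.Scalar → ℝ)
    (x : T.Scalar × T.VField × T.Scalar) : Prop :=
  x.1 ∈ T.V k S gh ∧ x.2.1 ∈ T.D l S ψh ∧ x.2.2 ∈ T.X m ∧
  (∀ v ∈ T.V k S 0, ∀ q ∈ T.D l S 0, s x.1 x.2.1 v q + T.bForm μ q v x.2.2 = 0) ∧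
  ∀ w ∈ T.X m, T.bForm μ x.2.1 x.1 w - sStar x.2.2 w = R w

/-- The full primal-dual system with `s* ≡ 0`. -/
def SolvesFull (k l m : ℕ) (S : Set (Pt d)) (gh : Pt d → ℝ)
    (ψh : Finset (Pt d) → MvPolynomial (Fin d) ℝ) (f : Pt d → ℝ)
    (A : Matrix (Fin d) (Fin d) ℝ) (μ γ : ℝ) (τ : Tikhonov)
    (x : T.Scalar × T.VField × T.Scalar) : Prop :=
  T.Solves k l m S gh ψh μ (T.sForm A (T.tForm μ γ k m τ)) (fun _ _ => 0) (fun w => load f w) x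

/-- One step of the defect correction iteration: `x` solves the system with the `L²` dual
stabilizer and right-hand side `(f, w)_Ω - s*(zOld, w)`. -/
def SolvesStep (k l m : ℕ) (S : Set (Pt d)) (gh : Pt d → ℝ)
    (ψh : Finset (Pt d) → MvPolynomial (Fin d) ℝ) (f : Pt d → ℝ)
    (A : Matrix (Fin d) (Fin d) ℝ) (μ γ : ℝ) (τ : Tikhonov)
    (zOld : T.Scalar) (x : T.Scalar × T.VField × T.Scalar) : Prop :=
  T.Solves k l m S gh ψh μ (T.sForm A (T.tForm μ γ k m τ)) T.sStarL2
    (fun w => load f w - T.sStarL2 zOld w) x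

end Mesh

end CauchyFEM

end

open CauchyFEM

/-! All spaces are finite dimensional. After subtracting one element of `V_g^k × D_ψ^l`, the claims
concern a saddle point problem with primal form `s`, constraint form `b` and dual form `c`, which is
zero or half the `L²` product. Two facts are needed: `s` is positive definite on `V_0^k × D_0^l`,
and `b(·, z) = 0` only for `z = 0`. Testing with the solution itself then makes the square system
injective, hence bijective (`saddleMap_bijective`), even for `c = 0`.

Definiteness (`sForm_self_pos`): the Tikhonov term controls `∇v` since `h > 0`; a continuous
elementwise constant function that vanishes on a face in `S` is zero; then the first term of `s`
controls `q`.

Nondegeneracy (`eq_zero_of_orthogonal_div`) says that the divergence maps `D_0^l` onto `W^l`. If `w`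
is orthogonal to the range, fields supported in one element with zero normal trace make `w` constant
there; lowest order fields across a shared face equate neighbouring constants; the elements are
connected through faces; a field through a boundary face outside `S` makes the constant zero.

Convergence (`tendsto_saddle_iteration`): the errors solve the homogeneous scheme. With `δ = z_{n+1}
- z_n`, one gets `c(δ, δ) = c(z_n, z_n) - c(z_{n+1}, z_{n+1}) - 2 s(e_n, e_n)`, so `c(δ, δ)` is
summable and `δ → 0`. The whole new error is a fixed linear image of `δ`, through the inverse of the
system with `c = 0`, so it vanishes in every norm. -/

noncomputable section

namespace CauchyFEM

section

/-! ### Saddle point problems and the augmented Lagrangian iteration in finite dimension -/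

section Saddle

variable {E W : Type*} [AddCommGroup E] [Module ℝ E] [AddCommGroup W] [Module ℝ W]

/-- The operator of the saddle point problem `s e v + b v z = φ v`, `b e w - c z w = ρ w`. -/
def saddleMap (s : E →ₗ[ℝ] E →ₗ[ℝ] ℝ) (b : E →ₗ[ℝ] W →ₗ[ℝ] ℝ) (c : W →ₗ[ℝ] W →ₗ[ℝ] ℝ) :
    E × W →ₗ[ℝ] (Module.Dual ℝ E) × (Module.Dual ℝ W) :=
  LinearMap.prod (s.coprod b.flip) (b.coprod (-c))

variable {s : E →ₗ[ℝ] E →ₗ[ℝ] ℝ} {b : E →ₗ[ℝ] W →ₗ[ℝ] ℝ} {c : W →ₗ[ℝ] W →ₗ[ℝ] ℝ}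

theorem saddleMap_eq_iff {x : E × W} {φ : Module.Dual ℝ E} {ρ : Module.Dual ℝ W} :
    saddleMap s b c x = (φ, ρ) ↔
      (∀ v, s x.1 v + b v x.2 = φ v) ∧ ∀ w, b x.1 w - c x.2 w = ρ w := by
  simp [saddleMap, Prod.ext_iff, LinearMap.ext_iff, sub_eq_add_neg]

/-- Testing the homogeneous system with `(e, z)` gives `s e e + c z z = 0`, so `e = 0`; then `b v z
= 0` for all `v`, so `z = 0`. Equal dimensions turn injectivity into bijectivity. -/
theorem saddleMap_bijective [FiniteDimensional ℝ E] [FiniteDimensional ℝ W]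
    (hs : ∀ e, e ≠ 0 → 0 < s e e) (hc : ∀ w, 0 ≤ c w w)
    (hb : ∀ w, (∀ e, b e w = 0) → w = 0) :
    Function.Bijective (saddleMap s b c) := by
  have hinj : Function.Injective (saddleMap s b c) := by
    rw [← LinearMap.ker_eq_bot, LinearMap.ker_eq_bot']
    rintro ⟨e, z⟩ h
    obtain ⟨h1, h2⟩ := saddleMap_eq_iff.1 (h : _ = ((0 : Module.Dual ℝ E), (0 : Module.Dual ℝ W)))
    have h1e := h1 e
    have h2z := h2 z
    simp only [LinearMap.zero_apply] at h1e h2z h1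
    have he : e = 0 := by
      by_contra hne
      linarith [hs e hne, hc z]
    subst he
    simp only [map_zero, LinearMap.zero_apply, zero_add] at h1
    simp [hb z h1]
  refine ⟨hinj, ?_⟩
  refine (LinearMap.injective_iff_surjective_of_finrank_eq_finrank ?_).1 hinj
  simp [Subspace.dual_finrank_eq]

theorem exists_bilin_le_norm {W : Type*} [NormedAddCommGroup W] [NormedSpace ℝ W]
    [FiniteDimensional ℝ W] (B : W →ₗ[ℝ] W →ₗ[ℝ] ℝ) :
    ∃ C, ∀ w, |B w w| ≤ C * (‖w‖ * ‖w‖) := by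
  let B' : W →L[ℝ] W →L[ℝ] ℝ := LinearMap.toContinuousLinearMap
    ((LinearMap.toContinuousLinearMap : (W →ₗ[ℝ] ℝ) ≃ₗ[ℝ] (W →L[ℝ] ℝ)).toLinearMap ∘ₗ B)
  exact ⟨‖B'‖, fun x => by rw [← mul_assoc]; exact B'.le_opNorm₂ x x⟩

/-- A bilinear form on a finite dimensional space is dominated by a positive definite one. -/
theorem exists_bilin_le [FiniteDimensional ℝ W] (m B : W →ₗ[ℝ] W →ₗ[ℝ] ℝ)
    (hsymm : ∀ x y, m x y = m y x) (hm : ∀ w, w ≠ 0 → 0 < m w w) :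
    ∃ C, ∀ w, |B w w| ≤ C * m w w := by
  -- With `m` as inner product, the claim is the continuity of a bilinear form on a finite
  -- dimensional normed space.
  let core : InnerProductSpace.Core ℝ W :=
    { inner := fun x y => m x y
      conj_inner_symm := fun x y => by simpa using hsymm y x
      re_inner_nonneg := fun x => by
        by_cases hx : x = 0
        · simp [hx]
        · simpa using (hm x hx).le
      add_left := fun x y z => by simp
      smul_left := fun x y r => by simp
      definite := fun x hx => by
        by_contra hne
        exact (hm x hne).ne' hx }
  let _ : NormedAddCommGroup W := core.toNormedAddCommGroup
  let _ : InnerProductSpace ℝ W := InnerProductSpace.ofCore core.toCore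
  have hin : ∀ x : W, m x x = ‖x‖ * ‖x‖ := fun x => real_inner_self_eq_norm_mul_norm x
  obtain ⟨C, hC⟩ := exists_bilin_le_norm B
  exact ⟨C, fun w => by rw [hin]; exact hC w⟩

/-- Convergence of the augmented Lagrangian (defect correction) iteration. -/
theorem tendsto_saddle_iteration [FiniteDimensional ℝ E] [FiniteDimensional ℝ W]
    (hs : ∀ e, e ≠ 0 → 0 < s e e) (hc : ∀ w, w ≠ 0 → 0 < c w w)
    (hsymm : ∀ x y, c x y = c y x)
    (hb : ∀ w, (∀ e, b e w = 0) → w = 0) (e : ℕ → E) (z : ℕ → W)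
    (h1 : ∀ n v, s (e n) v + b v (z (n + 1)) = 0)
    (h2 : ∀ n w, b (e n) w - c (z (n + 1)) w = - c (z n) w)
    (B : (E × W) →ₗ[ℝ] (E × W) →ₗ[ℝ] ℝ) :
    Tendsto (fun n => B (e n, z (n + 1)) (e n, z (n + 1))) atTop (𝓝 0) := by
  have hs0 : ∀ x, 0 ≤ s x x := fun x => by
    by_cases hx : x = 0
    · simp [hx]
    · exact (hs x hx).le
  have hc0 : ∀ x, 0 ≤ c x x := fun x => by
    by_cases hx : x = 0
    · simp [hx]
    · exact (hc x hx).le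
  -- Moving `c (z (n + 1))` to the right leaves the unstabilized system with data `(0, c (δ n))`, so
  -- the error is `Ψ (δ n)`.
  let Φ := LinearEquiv.ofBijective (saddleMap s b (0 : W →ₗ[ℝ] W →ₗ[ℝ] ℝ))
    (saddleMap_bijective hs (fun _ => le_rfl) hb)
  let Ψ : W →ₗ[ℝ] E × W := Φ.symm.toLinearMap ∘ₗ LinearMap.prod 0 c
  set δ : ℕ → W := fun n => z (n + 1) - z n with hδ
  have hΨ : ∀ n, (e n, z (n + 1)) = Ψ (δ n) := fun n => by
    refine (LinearEquiv.eq_symm_apply Φ).2 ?_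
    refine saddleMap_eq_iff.2 ⟨fun v => by simpa using h1 n v, fun w => ?_⟩
    have := h2 n w
    simp only [hδ, map_sub, LinearMap.sub_apply, LinearMap.zero_apply]
    linarith
  -- The equations tested with `e n` and `z (n + 1)` give `c (z (n + 1)) (z (n + 1)) - c (z n) (z (n
  -- + 1)) = -s (e n) (e n) ≤ 0`.
  have hstep : ∀ n, c (δ n) (δ n) ≤ c (z n) (z n) - c (z (n + 1)) (z (n + 1)) := fun n => by
    have a1 := h1 n (e n)
    have a2 := h2 n (z (n + 1))
    have a3 := hs0 (e n)
    have a4 := hsymm (z n) (z (n + 1))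
    simp only [hδ, map_sub, LinearMap.sub_apply]
    linarith
  have hsum : Summable fun n => c (δ n) (δ n) := by
    refine summable_of_sum_range_le (c := c (z 0) (z 0)) (fun n => hc0 _) fun n => ?_
    refine (Finset.sum_le_sum fun i _ => hstep i).trans ?_
    rw [Finset.sum_range_sub']
    linarith [hc0 (z n)]
  obtain ⟨C, hC⟩ := exists_bilin_le c (B.compl₁₂ Ψ Ψ) hsymm hc
  have hlim : Tendsto (fun n => C * c (δ n) (δ n)) atTop (𝓝 0) := by
    simpa using hsum.tendsto_atTop_zero.const_mul C
  refine squeeze_zero_norm (fun n => ?_) hlim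
  rw [hΨ n]
  exact hC (δ n)

end Saddle

end

/-! ### Polynomials, barycentric coordinates and single elements -/

section

section Polynomials

variable {d : ℕ}

@[simp] theorem evalAt_zero (x : Pt d) : evalAt (0 : MvPolynomial (Fin d) ℝ) x = 0 := by
  simp [evalAt]

@[simp] theorem evalAt_C (c : ℝ) (x : Pt d) : evalAt (MvPolynomial.C c) x = c := by
  simp [evalAt]

@[simp] theorem evalAt_X (i : Fin d) (x : Pt d) : evalAt (MvPolynomial.X i) x = x i := by
  simp [evalAt]

@[simp] theorem evalAt_add (p q : MvPolynomial (Fin d) ℝ) (x : Pt d) :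
    evalAt (p + q) x = evalAt p x + evalAt q x := by
  simp [evalAt]

@[simp] theorem evalAt_sub (p q : MvPolynomial (Fin d) ℝ) (x : Pt d) :
    evalAt (p - q) x = evalAt p x - evalAt q x := by
  simp [evalAt]

@[simp] theorem evalAt_mul (p q : MvPolynomial (Fin d) ℝ) (x : Pt d) :
    evalAt (p * q) x = evalAt p x * evalAt q x := by
  simp [evalAt]

@[simp] theorem evalAt_smul (c : ℝ) (p : MvPolynomial (Fin d) ℝ) (x : Pt d) :
    evalAt (c • p) x = c * evalAt p x := by
  simp [evalAt, MvPolynomial.smul_eval]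

@[simp] theorem evalAt_sum {ι : Type*} (s : Finset ι) (p : ι → MvPolynomial (Fin d) ℝ) (x : Pt d) :
    evalAt (∑ i ∈ s, p i) x = ∑ i ∈ s, evalAt (p i) x := by
  simp [evalAt]

theorem continuous_evalAt (p : MvPolynomial (Fin d) ℝ) : Continuous (evalAt p) :=
  (MvPolynomial.continuous_eval p).comp (PiLp.continuous_ofLp 2 _)

/-- A polynomial that vanishes on a nonempty open set is zero. -/
theorem eq_zero_of_evalAt_eq_zero {p : MvPolynomial (Fin d) ℝ} {U : Set (Pt d)} (hU : IsOpen U)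
    (hne : U.Nonempty) (h : ∀ x ∈ U, evalAt p x = 0) : p = 0 := by
  obtain ⟨x, hx⟩ := hne
  have hU' : IsOpen ((WithLp.toLp 2 : (Fin d → ℝ) → Pt d) ⁻¹' U) :=
    hU.preimage (PiLp.continuous_toLp 2 _)
  obtain ⟨ε, hε, hball⟩ := Metric.isOpen_iff.1 hU' (WithLp.ofLp x) hx
  refine MvPolynomial.funext_set (fun i => Metric.ball (x i) ε) (fun i => ?_) fun y hy => ?_
  · rw [Real.ball_eq_Ioo]
    exact Set.Ioo_infinite (by linarith)
  · rw [map_zero]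
    refine h (WithLp.toLp 2 y) (hball ?_)
    rw [ball_pi _ hε]
    exact hy

theorem totalDegree_pderiv_le (p : MvPolynomial (Fin d) ℝ) (i : Fin d) :
    (MvPolynomial.pderiv i p).totalDegree ≤ p.totalDegree - 1 := by
  classical
  refine Finset.sup_le fun m hm => ?_
  rw [MvPolynomial.mem_support_iff, MvPolynomial.coeff_pderiv] at hm
  have := MvPolynomial.le_totalDegree (MvPolynomial.mem_support_iff.2 (left_ne_zero_of_mul hm))
  rw [Finsupp.sum_add_index' (fun _ => rfl) (fun _ _ _ => rfl)] at this
  simp at this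
  simp
  omega

/-- A polynomial with vanishing gradient is constant. -/
theorem eq_C_of_pderiv_eq_zero {p : MvPolynomial (Fin d) ℝ}
    (h : ∀ i, MvPolynomial.pderiv i p = 0) : p = MvPolynomial.C (p.coeff 0) := by
  classical
  ext m
  rw [MvPolynomial.coeff_C]
  split_ifs with hm
  · rw [hm]
  · obtain ⟨i, hi⟩ : ∃ i, m i ≠ 0 := by
      by_contra! h'
      exact hm (Finsupp.ext fun i => (h' i).symm)
    -- The coefficient of `∂ᵢ p` at `m - eᵢ` is that of `p` at `m` times the nonzero number `m i`.
    have := congrArg (MvPolynomial.coeff (m - Finsupp.single i 1)) (h i)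
    rw [MvPolynomial.coeff_pderiv] at this
    have hadd : m - Finsupp.single i 1 + Finsupp.single i 1 = m :=
      tsub_add_cancel_of_le (by simpa [Finsupp.single_le_iff] using Nat.one_le_iff_ne_zero.2 hi)
    rw [hadd, MvPolynomial.coeff_zero] at this
    refine (mul_eq_zero.1 this).resolve_right ?_
    positivity

/-- The polynomial of degree one given by an affine function. -/
def affPoly (φ : Pt d →ᵃ[ℝ] ℝ) : MvPolynomial (Fin d) ℝ :=
  MvPolynomial.C (φ 0) +
    ∑ i, MvPolynomial.C (φ.linear (EuclideanSpace.single i 1)) * MvPolynomial.X i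

@[simp] theorem evalAt_affPoly (φ : Pt d →ᵃ[ℝ] ℝ) (x : Pt d) : evalAt (affPoly φ) x = φ x := by
  have hx : x = ∑ i, x i • EuclideanSpace.single i (1 : ℝ) := by
    ext j
    simp [Finset.sum_apply, Pi.single_apply]
  have := φ.linearMap_vsub x 0
  simp only [vsub_eq_sub, sub_zero] at this
  have h2 : φ.linear x = ∑ i, x i * φ.linear (EuclideanSpace.single i 1) := by
    conv_lhs => rw [hx]
    simp
  simp only [affPoly, evalAt_add, evalAt_C, evalAt_sum, evalAt_mul, evalAt_X]
  rw [sub_eq_iff_eq_add'.1 this.symm, h2]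
  simp [mul_comm]

theorem totalDegree_affPoly_le (φ : Pt d →ᵃ[ℝ] ℝ) : (affPoly φ).totalDegree ≤ 1 := by
  refine (MvPolynomial.totalDegree_add _ _).trans (max_le (by simp) ?_)
  refine MvPolynomial.totalDegree_finsetSum_le fun i _ => ?_
  refine (MvPolynomial.totalDegree_mul _ _).trans ?_
  simp

end Polynomials

section Barycentric

variable {d : ℕ}

/-- The coordinates are affine on all of space, not only on the simplex: their values at vertices of
neighbouring elements are essential later. -/
theorem exists_barycentric (K : Finset (Pt d)) (h : AffineIndependent ℝ ((↑) : K → Pt d))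
    (hc : K.card = d + 1) : ∃ φ : Pt d → (Pt d →ᵃ[ℝ] ℝ),
      (∀ a ∈ K, φ a a = 1) ∧ (∀ a ∈ K, ∀ b ∈ K, a ≠ b → φ a b = 0) ∧
      (∀ x, ∑ a ∈ K, φ a x = 1) ∧ (∀ x, ∑ a ∈ K, φ a x • a = x) ∧
      convexHull ℝ (K : Set (Pt d)) = {x | ∀ a ∈ K, 0 ≤ φ a x} ∧
      interior (convexHull ℝ (K : Set (Pt d))) = {x | ∀ a ∈ K, 0 < φ a x} := by
  classical
  have htop : affineSpan ℝ (Set.range ((↑) : K → Pt d)) = ⊤ := by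
    rw [h.affineSpan_eq_top_iff_card_eq_finrank_add_one]
    simp [hc]
  let b : AffineBasis K ℝ (Pt d) := ⟨(↑), h, htop⟩
  have hrange : Set.range b = (K : Set (Pt d)) := Subtype.range_coe
  refine ⟨fun a => if ha : a ∈ K then b.coord ⟨a, ha⟩ else 0, fun a ha => ?_,
    fun a ha a' ha' hne => ?_, fun x => ?_, fun x => ?_, ?_, ?_⟩
  · simp only [ha, dite_true]
    exact b.coord_apply_eq ⟨a, ha⟩
  · simp only [ha, dite_true]
    exact b.coord_apply_ne (i := ⟨a, ha⟩) (j := ⟨a', ha'⟩) (by simpa using hne)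
  · rw [← b.sum_coord_apply_eq_one x, ← Finset.sum_coe_sort K]
    simp
  · conv_rhs => rw [← b.linear_combination_coord_eq_self x]
    rw [← Finset.sum_coe_sort K]
    simp only [Finset.coe_mem, dite_true]
    rfl
  · rw [← hrange, b.convexHull_eq_nonneg_coord]
    ext x
    constructor
    · intro hx a ha
      simpa [ha] using hx ⟨a, ha⟩
    · intro hx a
      simpa using hx a a.2
  · rw [← hrange, b.interior_convexHull]
    ext x
    constructor
    · intro hx a ha
      simpa [ha] using hx ⟨a, ha⟩
    · intro hx a
      simpa using hx a a.2

end Barycentric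

namespace Mesh

variable {d : ℕ} {Ω : Set (Pt d)} {T : Mesh Ω}

namespace Element

/-- The barycentric coordinates of an element. -/
def bary (K : T.Element) : Pt d → (Pt d →ᵃ[ℝ] ℝ) :=
  (exists_barycentric K.1 (T.indep K.2.1) K.2.2).choose

theorem bary_self (K : T.Element) {a : Pt d} (ha : a ∈ K.1) : K.bary a a = 1 :=
  (exists_barycentric K.1 (T.indep K.2.1) K.2.2).choose_spec.1 a ha

theorem bary_of_ne (K : T.Element) {a b : Pt d} (ha : a ∈ K.1) (hb : b ∈ K.1) (h : a ≠ b) :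
    K.bary a b = 0 :=
  (exists_barycentric K.1 (T.indep K.2.1) K.2.2).choose_spec.2.1 a ha b hb h

theorem sum_bary (K : T.Element) (x : Pt d) : ∑ a ∈ K.1, K.bary a x = 1 :=
  (exists_barycentric K.1 (T.indep K.2.1) K.2.2).choose_spec.2.2.1 x

theorem sum_bary_smul (K : T.Element) (x : Pt d) : ∑ a ∈ K.1, K.bary a x • a = x :=
  (exists_barycentric K.1 (T.indep K.2.1) K.2.2).choose_spec.2.2.2.1 x

theorem mem_hull_iff (K : T.Element) {x : Pt d} : x ∈ K.hull ↔ ∀ a ∈ K.1, 0 ≤ K.bary a x :=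
  Set.ext_iff.1 (exists_barycentric K.1 (T.indep K.2.1) K.2.2).choose_spec.2.2.2.2.1 x

theorem mem_interior_hull_iff (K : T.Element) {x : Pt d} :
    x ∈ interior K.hull ↔ ∀ a ∈ K.1, 0 < K.bary a x :=
  Set.ext_iff.1 (exists_barycentric K.1 (T.indep K.2.1) K.2.2).choose_spec.2.2.2.2.2 x

theorem vertices_nonempty (K : T.Element) : K.1.Nonempty :=
  Finset.card_pos.1 (by rw [K.2.2]; omega)

theorem sum_bary_smul_sub (K : T.Element) (x y : Pt d) :
    ∑ a ∈ K.1, K.bary a x • (a - y) = x - y := by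
  simp_rw [smul_sub, Finset.sum_sub_distrib, ← Finset.sum_smul, K.sum_bary, K.sum_bary_smul,
    one_smul]

theorem interior_hull_nonempty (K : T.Element) : (interior K.hull).Nonempty := by
  have htop : affineSpan ℝ (convexHull ℝ (K.1 : Set (Pt d))) = ⊤ := by
    have := (T.indep K.2.1).affineSpan_eq_top_iff_card_eq_finrank_add_one.2
      (by simp [K.2.2])
    rwa [affineSpan_convexHull, ← Subtype.range_coe (s := (K.1 : Set (Pt d)))]
  exact (convex_convexHull ℝ _).interior_nonempty_iff_affineSpan_eq_top.2 htop

theorem isCompact_hull (K : T.Element) : IsCompact K.hull :=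
  K.1.finite_toSet.isCompact_convexHull ℝ

theorem measurableSet_hull (K : T.Element) : MeasurableSet K.hull :=
  K.isCompact_hull.isClosed.measurableSet

theorem volume_hull_pos (K : T.Element) : 0 < volume.real K.hull := by
  refine ENNReal.toReal_pos (fun h => ?_) K.isCompact_hull.measure_ne_top
  exact (isOpen_interior.measure_pos volume K.interior_hull_nonempty).ne'
    (measure_mono_null interior_subset h)

theorem integrableOn_hull (K : T.Element) {φ : Pt d → ℝ} (h : Continuous φ) :
    IntegrableOn φ K.hull :=
  h.continuousOn.integrableOn_compact K.isCompact_hull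

/-- A nonnegative continuous function with integral zero over an element vanishes in its
interior. -/
theorem eq_zero_of_integral_eq_zero (K : T.Element) {φ : Pt d → ℝ} (hφ : Continuous φ)
    (h0 : ∀ x ∈ K.hull, 0 ≤ φ x) (h : ∫ x in K.hull, φ x = 0) : ∀ x ∈ interior K.hull, φ x = 0 := by
  have h1 : φ =ᵐ[volume.restrict K.hull] 0 :=
    (setIntegral_eq_zero_iff_of_nonneg_ae
      ((ae_restrict_iff' K.measurableSet_hull).2 (ae_of_all _ h0)) (K.integrableOn_hull hφ)).1 h
  have h2 : φ =ᵐ[volume.restrict (interior K.hull)] 0 :=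
    ae_restrict_of_ae_restrict_of_subset interior_subset h1
  exact fun x hx => Measure.eqOn_open_of_ae_eq h2 isOpen_interior hφ.continuousOn
    continuousOn_const hx

theorem hull_subset_closure (K : T.Element) : K.hull ⊆ closure Ω := by
  rw [← T.space_eq]
  exact T.toSimplicialComplex.convexHull_subset_space K.2.1

end Element

end Mesh

end

/-! ### The forms and spaces of the method as linear algebra -/

section

namespace Mesh

variable {d : ℕ} {Ω : Set (Pt d)} {T : Mesh Ω}

section Forms

theorem integrableOn_evalAt_mul (K : T.Element) (p q : MvPolynomial (Fin d) ℝ) :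
    IntegrableOn (fun x => evalAt p x * evalAt q x) K.hull :=
  K.integrableOn_hull ((continuous_evalAt p).mul (continuous_evalAt q))

theorem l2_add_left (u v w : T.Scalar) : l2 (u + v) w = l2 u w + l2 v w := by
  simp only [l2, ← Finset.sum_add_distrib]
  refine Finset.sum_congr rfl fun K _ => ?_
  rw [← integral_add (integrableOn_evalAt_mul K _ _) (integrableOn_evalAt_mul K _ _)]
  simp [add_mul]

theorem l2_smul_left (c : ℝ) (v w : T.Scalar) : l2 (c • v) w = c * l2 v w := by
  simp only [l2, Finset.mul_sum]
  refine Finset.sum_congr rfl fun K _ => ?_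
  rw [← integral_const_mul]
  simp [mul_assoc]

theorem l2_comm (v w : T.Scalar) : l2 v w = l2 w v := by
  simp only [l2, mul_comm]

variable (T) in
/-- The scalar product of `L²(Ω)` as a bilinear map. -/
def l2Bilin : T.Scalar →ₗ[ℝ] T.Scalar →ₗ[ℝ] ℝ :=
  LinearMap.mk₂ ℝ l2 l2_add_left l2_smul_left
    (fun u v w => by rw [l2_comm, l2_add_left, l2_comm v, l2_comm w])
    (fun c u v => by rw [l2_comm, l2_smul_left, l2_comm v]; rfl)

@[simp] theorem l2Bilin_apply (v w : T.Scalar) : l2Bilin T v w = l2 v w := rfl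

theorem l2_self_nonneg (v : T.Scalar) : 0 ≤ l2 v v :=
  Finset.sum_nonneg fun _ _ => integral_nonneg fun _ => mul_self_nonneg _

/-- A `Scalar` is a family of polynomials, not of functions. Definiteness holds because elements
have nonempty interior, where a vanishing polynomial is zero. -/
theorem l2_self_eq_zero {v : T.Scalar} (h : l2 v v = 0) : v = 0 := by
  funext K
  have hK := (Finset.sum_eq_zero_iff_of_nonneg
    fun _ _ => integral_nonneg fun _ => mul_self_nonneg _).1 h K (Finset.mem_univ _)
  refine eq_zero_of_evalAt_eq_zero isOpen_interior K.interior_hull_nonempty fun x hx => ?_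
  exact mul_self_eq_zero.1 (K.eq_zero_of_integral_eq_zero
    ((continuous_evalAt _).mul (continuous_evalAt _)) (fun _ _ => mul_self_nonneg _) hK x hx)

theorem l2_self_pos {v : T.Scalar} (h : v ≠ 0) : 0 < l2 v v :=
  (l2_self_nonneg v).lt_of_ne fun h0 => h (l2_self_eq_zero h0.symm)

/-- The scalar product of vector fields is the sum of those of the components. -/
theorem l2v_eq_sum (p q : T.VField) : l2v p q = ∑ i, l2 (fun K => p K i) (fun K => q K i) := by
  simp only [l2v, l2]
  rw [Finset.sum_comm]
  refine Finset.sum_congr rfl fun K _ => ?_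
  exact integral_finsetSum _ fun i _ => integrableOn_evalAt_mul K _ _

theorem l2v_add_left (u v w : T.VField) : l2v (u + v) w = l2v u w + l2v v w := by
  simp only [l2v_eq_sum, ← Finset.sum_add_distrib]
  exact Finset.sum_congr rfl fun i _ => l2_add_left _ _ _

theorem l2v_smul_left (c : ℝ) (v w : T.VField) : l2v (c • v) w = c * l2v v w := by
  simp only [l2v_eq_sum, Finset.mul_sum]
  exact Finset.sum_congr rfl fun i _ => l2_smul_left _ _ _

theorem l2v_comm (v w : T.VField) : l2v v w = l2v w v := by
  simp only [l2v, mul_comm]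

variable (T) in
/-- The scalar product of vector fields as a bilinear map. -/
def l2vBilin : T.VField →ₗ[ℝ] T.VField →ₗ[ℝ] ℝ :=
  LinearMap.mk₂ ℝ l2v l2v_add_left l2v_smul_left
    (fun u v w => by rw [l2v_comm, l2v_add_left, l2v_comm v, l2v_comm w])
    (fun c u v => by rw [l2v_comm, l2v_smul_left, l2v_comm v]; rfl)

@[simp] theorem l2vBilin_apply (v w : T.VField) : l2vBilin T v w = l2v v w := rfl

theorem l2v_self_nonneg (v : T.VField) : 0 ≤ l2v v v := by
  rw [l2v_eq_sum]
  exact Finset.sum_nonneg fun _ _ => l2_self_nonneg _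

theorem l2v_self_eq_zero {v : T.VField} (h : l2v v v = 0) : v = 0 := by
  rw [l2v_eq_sum] at h
  funext K i
  have := (Finset.sum_eq_zero_iff_of_nonneg fun _ _ => l2_self_nonneg _).1 h i (Finset.mem_univ _)
  exact congrFun (l2_self_eq_zero this) K

variable (T) in
/-- The elementwise gradient as a linear map. -/
def gradL : T.Scalar →ₗ[ℝ] T.VField where
  toFun := grad
  map_add' u v := by ext1 K; ext1 i; simp [grad]
  map_smul' c v := by ext1 K; ext1 i; simp [grad]

@[simp] theorem gradL_apply (v : T.Scalar) : gradL T v = grad v := rfl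

variable (T) in
/-- The elementwise divergence as a linear map. -/
def divL : T.VField →ₗ[ℝ] T.Scalar where
  toFun := div
  map_add' p q := by ext1 K; simp [div, Finset.sum_add_distrib]
  map_smul' c q := by ext1 K; simp [div, Finset.smul_sum]

@[simp] theorem divL_apply (q : T.VField) : divL T q = div q := rfl

variable (T) in
/-- Multiplication by a constant matrix as a linear map. -/
def matMulL (A : Matrix (Fin d) (Fin d) ℝ) : T.VField →ₗ[ℝ] T.VField where
  toFun := matMul A
  map_add' p q := by ext1 K; ext1 i; simp [matMul, Finset.sum_add_distrib]
  map_smul' c q := by ext1 K; ext1 i; simp [matMul, Finset.smul_sum, smul_comm c]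

@[simp] theorem matMulL_apply (A : Matrix (Fin d) (Fin d) ℝ) (q : T.VField) :
    matMulL T A q = matMul A q := rfl

variable (T) in
/-- The load as a linear functional on piecewise polynomials. -/
def loadL (hconv : Convex ℝ Ω) (f : Pt d → ℝ)
    (hf : MemLp f 2 (volume.restrict Ω)) : T.Scalar →ₗ[ℝ] ℝ :=
  have hint : ∀ (K : T.Element) (p : MvPolynomial (Fin d) ℝ),
      IntegrableOn (fun x => f x * evalAt p x) K.hull := fun K p => by
    -- The elements fill `closure Ω`, while `f` is controlled on `Ω` only; the boundary of a convex
    -- set is null.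
    have hcl : volume.restrict (closure Ω) = volume.restrict Ω :=
      Measure.restrict_congr_set (closure_ae_eq_of_null_frontier (hconv.addHaar_frontier volume))
    have hfK : MemLp f 2 (volume.restrict K.hull) := by
      rw [← hcl] at hf
      exact hf.mono_measure (Measure.restrict_mono K.hull_subset_closure le_rfl)
    have : IsFiniteMeasure (volume.restrict K.hull) :=
      isFiniteMeasure_restrict.2 K.isCompact_hull.measure_ne_top
    have hf1 : IntegrableOn f K.hull := hfK.integrable (by norm_num)
    exact hf1.mul_continuousOn (continuous_evalAt p).continuousOn K.isCompact_hull
  { toFun := load f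
    map_add' := fun v w => by
      simp only [load, ← Finset.sum_add_distrib]
      refine Finset.sum_congr rfl fun K _ => ?_
      rw [← integral_add (hint K _) (hint K _)]
      simp [mul_add]
    map_smul' := fun c v => by
      simp only [load, RingHom.id_apply, smul_eq_mul, Finset.mul_sum]
      refine Finset.sum_congr rfl fun K _ => ?_
      rw [← integral_const_mul]
      simp [mul_left_comm] }

@[simp] theorem loadL_apply (hconv : Convex ℝ Ω) (f : Pt d → ℝ)
    (hf : MemLp f 2 (volume.restrict Ω)) (w : T.Scalar) : loadL T hconv f hf w = load f w := rfl

end Forms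

section Spaces

variable (T)

/-- `W^m` as a submodule. -/
def XSub (m : ℕ) : Submodule ℝ T.Scalar :=
  Submodule.pi Set.univ fun _ => MvPolynomial.restrictTotalDegree (Fin d) ℝ m

theorem mem_XSub {m : ℕ} {v : T.Scalar} : v ∈ T.XSub m ↔ v ∈ T.X m := by
  simp [XSub, X, Submodule.mem_pi, MvPolynomial.mem_restrictTotalDegree]

instance finiteDimensional_XSub (m : ℕ) : FiniteDimensional ℝ (T.XSub m) := by
  let e : T.XSub m →ₗ[ℝ] (T.Element → MvPolynomial.restrictTotalDegree (Fin d) ℝ m) :=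
    LinearMap.pi fun K => LinearMap.codRestrict _ (LinearMap.proj K ∘ₗ (T.XSub m).subtype)
      fun v => Submodule.mem_pi.1 v.2 K trivial
  refine FiniteDimensional.of_injective e fun v w h => Subtype.ext (funext fun K => ?_)
  exact congrArg Subtype.val (congrFun h K)

/-- The space `V_0^k` as a submodule. -/
def VSub (k : ℕ) (S : Set (Pt d)) : Submodule ℝ T.Scalar where
  carrier := T.V k S 0
  zero_mem' := ⟨⟨(T.mem_XSub).1 (zero_mem _), by simp⟩, fun _ _ _ _ _ _ => by simp⟩
  add_mem' := fun {u v} hu hv =>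
    ⟨⟨(T.mem_XSub).1 (add_mem ((T.mem_XSub).2 hu.1.1) ((T.mem_XSub).2 hv.1.1)),
      fun K K' x hx => by simp [hu.1.2 K K' x hx, hv.1.2 K K' x hx]⟩,
      fun F hF K hK x hx => by simp [hu.2 F hF K hK x hx, hv.2 F hF K hK x hx]⟩
  smul_mem' := fun c u hu =>
    ⟨⟨(T.mem_XSub).1 (Submodule.smul_mem _ c ((T.mem_XSub).2 hu.1.1)),
      fun K K' x hx => by simp [hu.1.2 K K' x hx]⟩,
      fun F hF K hK x hx => by simp [hu.2 F hF K hK x hx]⟩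

instance finiteDimensional_VSub (k : ℕ) (S : Set (Pt d)) : FiniteDimensional ℝ (T.VSub k S) :=
  Submodule.finiteDimensional_of_le (S₂ := T.XSub k) fun _ hv => (T.mem_XSub).2 hv.1.1

theorem comp_add (p q : Fin d → MvPolynomial (Fin d) ℝ) (n x : Pt d) :
    comp (p + q) n x = comp p n x + comp q n x := by
  simp [comp, add_mul, Finset.sum_add_distrib]

theorem comp_smul (c : ℝ) (q : Fin d → MvPolynomial (Fin d) ℝ) (n x : Pt d) :
    comp (c • q) n x = c * comp q n x := by
  simp [comp, Finset.mul_sum, mul_assoc]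

theorem comp_zero (n x : Pt d) : comp (0 : Fin d → MvPolynomial (Fin d) ℝ) n x = 0 := by
  simp [comp]

/-- The local Raviart-Thomas space. -/
def localRT (d l : ℕ) : Submodule ℝ (Fin d → MvPolynomial (Fin d) ℝ) where
  carrier := {q | ∃ s : MvPolynomial (Fin d) ℝ, s.totalDegree ≤ l ∧
    ∀ i, (q i - MvPolynomial.X i * s).totalDegree ≤ l}
  zero_mem' := ⟨0, by simp⟩
  add_mem' := by
    rintro p q ⟨s, hs, hp⟩ ⟨t, ht, hq⟩
    refine ⟨s + t, (MvPolynomial.totalDegree_add _ _).trans (max_le hs ht), fun i => ?_⟩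
    have : (p + q) i - MvPolynomial.X i * (s + t) =
      (p i - MvPolynomial.X i * s) + (q i - MvPolynomial.X i * t) := by
        simp only [Pi.add_apply]; ring
    rw [this]
    exact (MvPolynomial.totalDegree_add _ _).trans (max_le (hp i) (hq i))
  smul_mem' := by
    rintro c q ⟨s, hs, hq⟩
    refine ⟨c • s, (MvPolynomial.totalDegree_smul_le _ _).trans hs, fun i => ?_⟩
    have : (c • q) i - MvPolynomial.X i * (c • s) = c • (q i - MvPolynomial.X i * s) := by
      simp [smul_sub]
    rw [this]
    exact (MvPolynomial.totalDegree_smul_le _ _).trans (hq i)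

theorem totalDegree_le_of_mem_localRT {l : ℕ} {q : Fin d → MvPolynomial (Fin d) ℝ}
    (hq : q ∈ localRT d l) (i : Fin d) : (q i).totalDegree ≤ l + 1 := by
  obtain ⟨s, hs, h⟩ := hq
  rw [← sub_add_cancel (q i) (MvPolynomial.X i * s)]
  refine (MvPolynomial.totalDegree_add _ _).trans (max_le ((h i).trans (by omega)) ?_)
  refine (MvPolynomial.totalDegree_mul _ _).trans ?_
  rw [MvPolynomial.totalDegree_X]
  omega

/-- The space `D_0^l` as a submodule. -/
def DSub (l : ℕ) (S : Set (Pt d)) : Submodule ℝ T.VField where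
  carrier := T.D l S 0
  zero_mem' := ⟨⟨fun _ => (localRT d l).zero_mem, fun _ _ _ _ _ _ _ _ _ _ => rfl⟩,
    fun _ _ _ _ _ _ _ _ => by simpa using comp_zero _ _⟩
  add_mem' := fun {p q} hp hq =>
    ⟨⟨fun K => (localRT d l).add_mem (hp.1.1 K) (hq.1.1 K), fun K K' F hF h h' n hn x hx => by
      rw [Pi.add_apply, Pi.add_apply, comp_add, comp_add, hp.1.2 K K' F hF h h' n hn x hx,
        hq.1.2 K K' F hF h h' n hn x hx]⟩,
    fun F hF K hK ν hν x hx => by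
      rw [Pi.add_apply, comp_add, hp.2 F hF K hK ν hν x hx, hq.2 F hF K hK ν hν x hx]
      simp⟩
  smul_mem' := fun c q hq =>
    ⟨⟨fun K => (localRT d l).smul_mem c (hq.1.1 K), fun K K' F hF h h' n hn x hx => by
      rw [Pi.smul_apply, Pi.smul_apply, comp_smul, comp_smul, hq.1.2 K K' F hF h h' n hn x hx]⟩,
    fun F hF K hK ν hν x hx => by
      rw [Pi.smul_apply, comp_smul, hq.2 F hF K hK ν hν x hx]
      simp⟩

instance finiteDimensional_DSub (l : ℕ) (S : Set (Pt d)) : FiniteDimensional ℝ (T.DSub l S) := by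
  let e : T.DSub l S →ₗ[ℝ]
      (T.Element → Fin d → MvPolynomial.restrictTotalDegree (Fin d) ℝ (l + 1)) :=
    LinearMap.pi fun K => LinearMap.pi fun i => LinearMap.codRestrict _
      (LinearMap.proj i ∘ₗ LinearMap.proj K ∘ₗ (T.DSub l S).subtype)
      fun v => (MvPolynomial.mem_restrictTotalDegree _ _ _).2
        (totalDegree_le_of_mem_localRT (v.2.1.1 K) i)
  refine FiniteDimensional.of_injective e fun v w h => Subtype.ext ?_
  funext K i
  exact congrArg Subtype.val (congrFun (congrFun h K) i)

end Spaces

section Projection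

variable (T)

/-- The Gram map of `W^m` is injective by definiteness, hence onto the dual. Uniqueness is what
makes `piW`, defined by choice, linear. -/
theorem existsUnique_proj (m : ℕ) (v : T.Scalar) :
    ∃! w, w ∈ T.X m ∧ ∀ y ∈ T.X m, l2 (v - w) y = 0 := by
  let B : T.XSub m →ₗ[ℝ] Module.Dual ℝ (T.XSub m) :=
    (l2Bilin T).compl₁₂ (T.XSub m).subtype (T.XSub m).subtype
  have hinj : Function.Injective B := by
    rw [← LinearMap.ker_eq_bot, LinearMap.ker_eq_bot']
    intro w hw
    exact Subtype.ext (l2_self_eq_zero (LinearMap.congr_fun hw w))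
  have hsurj := (LinearMap.injective_iff_surjective_of_finrank_eq_finrank
    Subspace.dual_finrank_eq.symm).1 hinj
  obtain ⟨w, hw⟩ := hsurj (l2Bilin T v ∘ₗ (T.XSub m).subtype)
  have hw' : ∀ y ∈ T.X m, l2 (v - (w : T.Scalar)) y = 0 := fun y hy => by
    have := LinearMap.congr_fun hw ⟨y, (T.mem_XSub).2 hy⟩
    have h2 : l2Bilin T (v - (w : T.Scalar)) y = l2Bilin T v y - l2Bilin T w y := by simp
    rw [← l2Bilin_apply, h2, sub_eq_zero]
    exact this.symm
  refine ⟨w, ⟨(T.mem_XSub).1 w.2, hw'⟩, fun y ⟨hy, hy'⟩ => ?_⟩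
  have hsub : (w : T.Scalar) - y ∈ T.X m :=
    (T.mem_XSub).1 (sub_mem w.2 ((T.mem_XSub).2 hy))
  have h1 := hw' _ hsub
  have h2 := hy' _ hsub
  refine (sub_eq_zero.1 (l2_self_eq_zero (v := (w : T.Scalar) - y) ?_)).symm
  have h3 : l2Bilin T ((w : T.Scalar) - y) (w - y) =
      l2Bilin T (v - y) (w - y) - l2Bilin T (v - w) (w - y) := by
    rw [← LinearMap.sub_apply, ← map_sub]
    congr 2
    abel
  rw [← l2Bilin_apply, h3, l2Bilin_apply, l2Bilin_apply, h1, h2, sub_zero]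

theorem piW_spec (m : ℕ) (v : T.Scalar) :
    T.piW m v ∈ T.X m ∧ ∀ y ∈ T.X m, l2 (v - T.piW m v) y = 0 :=
  Classical.epsilon_spec (T.existsUnique_proj m v).exists

theorem piW_eq {m : ℕ} {v w : T.Scalar} (hw : w ∈ T.X m) (h : ∀ y ∈ T.X m, l2 (v - w) y = 0) :
    T.piW m v = w :=
  (T.existsUnique_proj m v).unique (T.piW_spec m v) ⟨hw, h⟩

/-- The `L²(Ω)`-projection onto `W^m` as a linear map. -/
def piWL (m : ℕ) : T.Scalar →ₗ[ℝ] T.Scalar where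
  toFun := T.piW m
  map_add' u v := T.piW_eq
    ((T.mem_XSub).1 (add_mem ((T.mem_XSub).2 (T.piW_spec m u).1)
      ((T.mem_XSub).2 (T.piW_spec m v).1)))
    fun y hy => by
      rw [add_sub_add_comm, l2_add_left, (T.piW_spec m u).2 y hy, (T.piW_spec m v).2 y hy, add_zero]
  map_smul' c v := T.piW_eq
    ((T.mem_XSub).1 (Submodule.smul_mem _ c ((T.mem_XSub).2 (T.piW_spec m v).1)))
    fun y hy => by
      rw [RingHom.id_apply, ← smul_sub, l2_smul_left, (T.piW_spec m v).2 y hy, mul_zero]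

@[simp] theorem piWL_apply (m : ℕ) (v : T.Scalar) : T.piWL m v = T.piW m v := rfl

/-- The Tikhonov form as a bilinear map. -/
def tBilin (μ γ : ℝ) (k m : ℕ) : Tikhonov → (T.Scalar →ₗ[ℝ] T.Scalar →ₗ[ℝ] ℝ)
  | .reduced => (1 / 2 * γ * T.meshSize ^ (2 * k)) • (l2vBilin T).compl₁₂ (gradL T) (gradL T)
  | .primalDual =>
      (1 / 2 * μ ^ 2 * T.meshSize ^ 2) •
        (l2Bilin T).compl₁₂ (LinearMap.id - T.piWL m) (LinearMap.id - T.piWL m)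
      + (γ * T.meshSize ^ (2 * k)) • (l2vBilin T).compl₁₂ (gradL T) (gradL T)

theorem tBilin_apply (μ γ : ℝ) (k m : ℕ) (τ : Tikhonov) (u v : T.Scalar) :
    T.tBilin μ γ k m τ u v = T.tForm μ γ k m τ u v := by
  cases τ <;> rfl

/-- The primal stabilizer as a bilinear map on pairs. -/
def sBilin (A : Matrix (Fin d) (Fin d) ℝ) (μ γ : ℝ) (k m : ℕ) (τ : Tikhonov) :
    (T.Scalar × T.VField) →ₗ[ℝ] (T.Scalar × T.VField) →ₗ[ℝ] ℝ :=
  (1 / 2 : ℝ) • (l2vBilin T).compl₁₂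
      (matMulL T A ∘ₗ gradL T ∘ₗ LinearMap.fst _ _ _ - LinearMap.snd _ _ _)
      (matMulL T A ∘ₗ gradL T ∘ₗ LinearMap.fst _ _ _ - LinearMap.snd _ _ _)
    + (T.tBilin μ γ k m τ).compl₁₂ (LinearMap.fst _ _ _) (LinearMap.fst _ _ _)

theorem sBilin_apply (A : Matrix (Fin d) (Fin d) ℝ) (μ γ : ℝ) (k m : ℕ) (τ : Tikhonov)
    (x y : T.Scalar × T.VField) :
    T.sBilin A μ γ k m τ x y = T.sForm A (T.tForm μ γ k m τ) x.1 x.2 y.1 y.2 := by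
  rw [sForm, ← tBilin_apply]
  rfl

/-- The constraint form as a bilinear map on pairs. -/
def bBilin (μ : ℝ) : (T.Scalar × T.VField) →ₗ[ℝ] T.Scalar →ₗ[ℝ] ℝ :=
  l2Bilin T ∘ₗ (divL T ∘ₗ LinearMap.snd _ _ _ + μ • LinearMap.fst _ _ _)

theorem bBilin_apply (μ : ℝ) (x : T.Scalar × T.VField) (w : T.Scalar) :
    T.bBilin μ x w = T.bForm μ x.2 x.1 w := rfl

end Projection

end Mesh

end

/-! ### Integrals of divergences by dilation towards a vertex -/

section

variable {d : ℕ}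

/-- The divergence of a polynomial vector field. -/
def polyDiv (q : Fin d → MvPolynomial (Fin d) ℝ) : MvPolynomial (Fin d) ℝ :=
  ∑ i, MvPolynomial.pderiv i (q i)

/-- The vector field `p(x) (x - a)`. -/
def radial (p : MvPolynomial (Fin d) ℝ) (a : Pt d) : Fin d → MvPolynomial (Fin d) ℝ :=
  fun i => p * (MvPolynomial.X i - MvPolynomial.C (a i))

/-- The derivative of `p` in the direction `v`. -/
def dirDeriv (v : Pt d) (p : MvPolynomial (Fin d) ℝ) : MvPolynomial (Fin d) ℝ :=
  ∑ i, MvPolynomial.C (v i) * MvPolynomial.pderiv i p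

theorem evalAt_polyDiv_radial (p : MvPolynomial (Fin d) ℝ) (a x : Pt d) :
    evalAt (polyDiv (radial p a)) x =
      d * evalAt p x + ∑ i, evalAt (MvPolynomial.pderiv i p) x * (x i - a i) := by
  simp only [polyDiv, radial, evalAt_sum, MvPolynomial.pderiv_mul, evalAt_add, evalAt_mul,
    evalAt_sub, evalAt_X, evalAt_C, map_sub, MvPolynomial.pderiv_X_self, MvPolynomial.pderiv_C,
    Finset.sum_add_distrib, sub_zero]
  simp [evalAt, add_comm]

theorem hasDerivAt_evalAt_line (p : MvPolynomial (Fin d) ℝ) (a v : Pt d) (s : ℝ) :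
    HasDerivAt (fun s : ℝ => evalAt p (a + s • v))
      (∑ i, evalAt (MvPolynomial.pderiv i p) (a + s • v) * v i) s := by
  classical
  induction p using MvPolynomial.induction_on with
  | C c => simpa using hasDerivAt_const s c
  | add p q hp hq =>
    have := hp.add hq
    simp only [map_add, evalAt_add, add_mul, Finset.sum_add_distrib]
    exact this
  | mul_X p j hp =>
    have hX : HasDerivAt (fun s : ℝ => (a + s • v) j) (v j) s := by
      simpa using ((hasDerivAt_id s).mul_const (v j)).const_add (a j)
    have := hp.mul hX
    simp only [evalAt_mul, evalAt_X]
    convert! this using 1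
    simp only [MvPolynomial.pderiv_mul, evalAt_add, evalAt_mul, evalAt_X, add_mul,
      Finset.sum_add_distrib, Finset.sum_mul]
    congr 1
    · exact Finset.sum_congr rfl fun i _ => by ring
    · rw [Finset.sum_eq_single j]
      · simp [evalAt]
      · intro i _ hi
        simp [MvPolynomial.pderiv_X_of_ne hi.symm]
      · simp

theorem continuous_line_deriv (p : MvPolynomial (Fin d) ℝ) (a : Pt d) :
    Continuous fun z : ℝ × Pt d =>
      ∑ i, evalAt (MvPolynomial.pderiv i p) (a + z.1 • (z.2 - a)) * (z.2 - a) i := by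
  refine continuous_finsetSum _ fun i _ => ((continuous_evalAt _).comp ?_).mul ?_
  · exact continuous_const.add (continuous_fst.smul (continuous_snd.sub continuous_const))
  · exact (PiLp.continuous_apply 2 _ i).comp (continuous_snd.sub continuous_const)

namespace Mesh

variable {Ω : Set (Pt d)} {T : Mesh Ω}

namespace Element

variable (K : T.Element)

theorem bary_line (a y : Pt d) (b : Pt d) (s : ℝ) :
    K.bary b (a + s • (y - a)) = (1 - s) * K.bary b a + s * K.bary b y := by
  have : a + s • (y - a) = AffineMap.lineMap a y s := by
    simp [AffineMap.lineMap_apply, add_comm]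
  rw [this, AffineMap.apply_lineMap, AffineMap.lineMap_apply]
  simp
  ring

theorem subset_hull : (K.1 : Set (Pt d)) ⊆ K.hull := subset_convexHull ℝ _

theorem integral_shrink (a : Pt d) (φ : Pt d → ℝ) {s : ℝ} (hs : 0 < s) :
    ∫ x in (fun y => a + s • (y - a)) '' K.hull, φ x =
      s ^ d * ∫ y in K.hull, φ (a + s • (y - a)) := by
  have hder : ∀ y ∈ K.hull, HasFDerivWithinAt (fun y => a + s • (y - a))
      (s • ContinuousLinearMap.id ℝ (Pt d)) K.hull y := fun y _ =>
    ((((hasFDerivAt_id y).sub_const a).const_smul s).const_add a).hasFDerivWithinAt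
  have hinj : Set.InjOn (fun y => a + s • (y - a)) K.hull := fun y _ z _ h => by
    simpa [hs.ne'] using h
  rw [integral_image_eq_integral_abs_det_fderiv_smul volume K.measurableSet_hull hder hinj]
  have hdet : |(s • ContinuousLinearMap.id ℝ (Pt d)).det| = s ^ d := by
    rw [ContinuousLinearMap.det, ContinuousLinearMap.toLinearMap_smul, LinearMap.det_smul]
    simp [abs_of_pos hs]
  simp only [hdet, smul_eq_mul, integral_const_mul]

theorem hasDerivAt_setIntegral {F F' : ℝ → Pt d → ℝ} (hF : ∀ s, Continuous (F s))
    (hF' : Continuous fun z : ℝ × Pt d => F' z.1 z.2)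
    (h : ∀ s y, HasDerivAt (fun s => F s y) (F' s y) s) (s₀ : ℝ) :
    HasDerivAt (fun s => ∫ y in K.hull, F s y) (∫ y in K.hull, F' s₀ y) s₀ := by
  obtain ⟨C, hC⟩ := ((isCompact_Icc (a := s₀ - 1) (b := s₀ + 1)).prod
    K.isCompact_hull).exists_bound_of_continuousOn hF'.continuousOn
  have hmeas : AEStronglyMeasurable (F' s₀) (volume.restrict K.hull) :=
    (hF'.comp (Continuous.prodMk_right s₀)).aestronglyMeasurable
  have hbd : ∀ᵐ y ∂volume.restrict K.hull, ∀ s ∈ Set.Icc (s₀ - 1) (s₀ + 1), ‖F' s y‖ ≤ C :=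
    (ae_restrict_iff' K.measurableSet_hull).2 (ae_of_all _ fun y hy s hs => hC (s, y) ⟨hs, hy⟩)
  exact (hasDerivAt_integral_of_dominated_loc_of_deriv_le
    (Icc_mem_nhds (by linarith) (by linarith))
    (Eventually.of_forall fun s => (hF s).aestronglyMeasurable)
    (K.integrableOn_hull (hF s₀)) hmeas hbd (K.integrableOn_hull continuous_const)
    (ae_of_all _ fun y s _ => h s y)).2

/-- At `s = 1` the product rule yields `d p + ∇p · (y - a)` under the integral, which is the
divergence of `p (y - a)`. -/
theorem hasDerivAt_integral_scaled (p : MvPolynomial (Fin d) ℝ) (a : Pt d) :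
    HasDerivAt (fun s : ℝ => s ^ d * ∫ y in K.hull, evalAt p (a + s • (y - a)))
      (∫ y in K.hull, evalAt (polyDiv (radial p a)) y) 1 := by
  have hcont' := continuous_line_deriv p a
  have hF1 : Continuous fun y : Pt d =>
      ∑ i, evalAt (MvPolynomial.pderiv i p) (a + (1 : ℝ) • (y - a)) * (y - a) i :=
    continuous_finsetSum _ fun i _ => ((continuous_evalAt _).comp (by fun_prop)).mul
      ((PiLp.continuous_apply 2 _ i).comp (by fun_prop))
  have hcomp : ∀ s : ℝ, Continuous fun y => evalAt p (a + s • (y - a)) := fun s =>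
    (continuous_evalAt p).comp (by fun_prop)
  have key := K.hasDerivAt_setIntegral hcomp hcont'
    (fun s y => hasDerivAt_evalAt_line p a (y - a) s) 1
  have hval : ∫ y in K.hull, evalAt (polyDiv (radial p a)) y =
      d * (∫ y in K.hull, evalAt p (a + (1 : ℝ) • (y - a))) + ∫ y in K.hull, ∑ i,
        evalAt (MvPolynomial.pderiv i p) (a + (1 : ℝ) • (y - a)) * (y - a) i := by
    have h1 : IntegrableOn (fun y => (d : ℝ) * evalAt p (a + (1 : ℝ) • (y - a))) K.hull :=
      K.integrableOn_hull (continuous_const.mul (hcomp 1))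
    rw [← integral_const_mul, ← integral_add h1 (K.integrableOn_hull hF1)]
    refine integral_congr_ae (ae_of_all _ fun y => ?_)
    simp [evalAt_polyDiv_radial]
  have hmul := (hasDerivAt_pow d (1 : ℝ)).mul key
  rw [one_pow, one_pow, mul_one, one_mul, ← hval] at hmul
  exact hmul

/-- The divergence theorem for the field `λ_a p (x - a)`, whose normal component vanishes on
the boundary of the element. -/
theorem integral_polyDiv_bubble {a : Pt d} (ha : a ∈ K.1) (p : MvPolynomial (Fin d) ℝ) :
    ∫ y in K.hull, evalAt (polyDiv (radial (affPoly (K.bary a) * p) a)) y = 0 := by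
  set G := affPoly (K.bary a) * p with hG
  -- For `s > 0` this is the integral of `G` over `K` shrunk by the factor `s` towards `a`. Its left
  -- derivative at `1` is computed in two ways.
  set I : ℝ → ℝ := fun s => s ^ d * ∫ y in K.hull, evalAt G (a + s • (y - a)) with hI
  obtain ⟨C, hC⟩ := K.isCompact_hull.exists_bound_of_continuousOn (continuous_evalAt p).continuousOn
  have hC0 : 0 ≤ C := (norm_nonneg _).trans (hC a (K.subset_hull ha))
  -- The difference is an integral over the layer cut off next to the face opposite `a`. The layer
  -- has volume of order `1 - s`, and the factor `λ_a` of `G` is at most `1 - s` there, so the total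
  -- is of second order.
  have hbound : ∀ s ∈ Set.Ioo (0 : ℝ) 1,
      ‖I 1 - I s‖ ≤ C * (1 - s) * ((1 - s ^ d) * volume.real K.hull) := by
    rintro s ⟨hs0, hs1⟩
    set Ks := (fun y => a + s • (y - a)) '' K.hull with hKs
    have hKsK : Ks ⊆ K.hull := by
      rintro _ ⟨y, hy, rfl⟩
      rw [K.mem_hull_iff] at hy ⊢
      intro b hb
      have h1 := hy b hb
      have h2 := K.mem_hull_iff.1 (K.subset_hull ha) b hb
      rw [K.bary_line]
      have : 0 ≤ 1 - s := by linarith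
      positivity
    have hKsc : IsCompact Ks := K.isCompact_hull.image (by fun_prop)
    have hKsm : MeasurableSet Ks := hKsc.isClosed.measurableSet
    have hvol : volume.real (K.hull \ Ks) = (1 - s ^ d) * volume.real K.hull := by
      rw [measureReal_sdiff hKsK hKsm K.isCompact_hull.measure_ne_top]
      have := K.integral_shrink a (fun _ => 1) hs0
      rw [← hKs] at this
      simp only [setIntegral_const, smul_eq_mul, mul_one] at this
      rw [this]
      ring
    have hdiff : I 1 - I s = ∫ x in K.hull \ Ks, evalAt G x := by
      rw [setIntegral_sdiff hKsm (K.integrableOn_hull (continuous_evalAt G)) hKsK, hKs,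
        K.integral_shrink a _ hs0]
      simp [hI]
    rw [hdiff, ← hvol]
    refine norm_setIntegral_le_of_norm_le_const
      ((measure_mono Set.sdiff_subset).trans_lt K.isCompact_hull.measure_lt_top) ?_
    rintro x ⟨hx, hxs⟩
    have hx' := K.mem_hull_iff.1 hx
    -- Otherwise dilating `x` back by `s⁻¹` stays in `K`: `λ_a` becomes `s⁻¹ (s - 1 + λ_a(x))` and
    -- the other coordinates are multiplied by `s⁻¹`.
    have hla : K.bary a x ≤ 1 - s := by
      by_contra! hlt
      refine hxs ⟨a + s⁻¹ • (x - a), ?_, ?_⟩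
      · rw [K.mem_hull_iff]
        intro b hb
        rw [K.bary_line]
        by_cases hab : b = a
        · rw [hab, K.bary_self ha]
          have : 0 ≤ s⁻¹ * (s - 1 + K.bary a x) :=
            mul_nonneg (inv_nonneg.2 hs0.le) (by linarith)
          calc (0 : ℝ) ≤ s⁻¹ * (s - 1 + K.bary a x) := this
            _ = _ := by field_simp
        · rw [K.bary_of_ne hb ha hab, mul_zero, zero_add]
          exact mul_nonneg (inv_nonneg.2 hs0.le) (hx' b hb)
      · simp [smul_smul, mul_inv_cancel₀ hs0.ne']
    rw [hG, evalAt_mul, norm_mul, evalAt_affPoly, Real.norm_of_nonneg (hx' a ha), mul_comm]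
    exact mul_le_mul (hC x hx) hla (hx' a ha) hC0
  have hslope := (hasDerivAt_iff_tendsto_slope.1 (K.hasDerivAt_integral_scaled G a)).mono_left
    (nhdsWithin_mono (1 : ℝ) (s := Set.Iio 1) (fun s (hs : s < 1) => hs.ne))
  refine tendsto_nhds_unique hslope ?_
  have hlim : Tendsto (fun s : ℝ => C * ((1 - s ^ d) * volume.real K.hull)) (𝓝[<] 1) (𝓝 0) := by
    have : Continuous fun s : ℝ => C * ((1 - s ^ d) * volume.real K.hull) := by fun_prop
    simpa using (this.tendsto 1).mono_left nhdsWithin_le_nhds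
  refine squeeze_zero_norm' ?_ hlim
  filter_upwards [Ioo_mem_nhdsLT (show (0 : ℝ) < 1 by norm_num)] with s hs
  have h1s : 0 < 1 - s := sub_pos.2 hs.2
  rw [slope_def_field, norm_div, ← norm_neg (_ - _), neg_sub, div_le_iff₀ (by
    rw [norm_pos_iff]; linarith), Real.norm_of_nonpos (by linarith : s - 1 ≤ 0)]
  refine (hbound s hs).trans_eq ?_
  ring

end Element

end Mesh

end

/-! ### Orthogonality to local bubble divergences forces constants -/

section

variable {d : ℕ}

/-- The gradient of a polynomial at a point. -/
def gradAt (p : MvPolynomial (Fin d) ℝ) (x : Pt d) : Pt d :=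
  WithLp.toLp 2 fun i => evalAt (MvPolynomial.pderiv i p) x

theorem inner_gradAt (p : MvPolynomial (Fin d) ℝ) (v x : Pt d) :
    inner ℝ v (gradAt p x) = ∑ i, evalAt (MvPolynomial.pderiv i p) x * v i := by
  simp [gradAt, PiLp.inner_apply]

theorem evalAt_dirDeriv (v : Pt d) (p : MvPolynomial (Fin d) ℝ) (x : Pt d) :
    evalAt (dirDeriv v p) x = inner ℝ v (gradAt p x) := by
  simp [dirDeriv, inner_gradAt, mul_comm]

theorem evalAt_polyDiv_radial_mul (p w : MvPolynomial (Fin d) ℝ) (a x : Pt d) :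
    evalAt (polyDiv (radial (p * w) a)) x =
      evalAt (polyDiv (radial p a)) x * evalAt w x +
        evalAt p x * inner ℝ (x - a) (gradAt w x) := by
  simp only [evalAt_polyDiv_radial, inner_gradAt, MvPolynomial.pderiv_mul, evalAt_add, evalAt_mul,
    add_mul, Finset.sum_add_distrib, Finset.sum_mul, Finset.mul_sum, PiLp.sub_apply]
  rw [add_assoc, ← mul_assoc]
  congr 2
  · exact Finset.sum_congr rfl fun i _ => by ring
  · exact Finset.sum_congr rfl fun i _ => by ring

theorem polyDiv_sum {ι : Type*} (s : Finset ι) (q : ι → Fin d → MvPolynomial (Fin d) ℝ) :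
    polyDiv (∑ j ∈ s, q j) = ∑ j ∈ s, polyDiv (q j) := by
  simp only [polyDiv, Finset.sum_apply, map_sum]
  exact Finset.sum_comm

theorem comp_radial (p : MvPolynomial (Fin d) ℝ) (a n x : Pt d) :
    Mesh.comp (radial p a) n x = evalAt p x * inner ℝ (x - a) n := by
  simp only [Mesh.comp, radial, evalAt_mul, evalAt_sub, evalAt_X, evalAt_C, PiLp.inner_apply,
    Finset.mul_sum, PiLp.sub_apply]
  exact Finset.sum_congr rfl fun i _ => by simp; ring

theorem comp_sum {ι : Type*} (s : Finset ι) (q : ι → Fin d → MvPolynomial (Fin d) ℝ) (n x : Pt d) :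
    Mesh.comp (∑ j ∈ s, q j) n x = ∑ j ∈ s, Mesh.comp (q j) n x := by
  simp only [Mesh.comp, Finset.sum_apply, evalAt_sum, Finset.sum_mul]
  exact Finset.sum_comm

theorem radial_mem_localRT {l : ℕ} {p : MvPolynomial (Fin d) ℝ} (hp : p.totalDegree ≤ l)
    (a : Pt d) : radial p a ∈ Mesh.localRT d l := by
  refine ⟨p, hp, fun i => ?_⟩
  have : radial p a i - MvPolynomial.X i * p = (-a i) • p := by
    rw [radial, MvPolynomial.smul_eq_C_mul, map_neg]
    ring
  rw [this]
  exact (MvPolynomial.totalDegree_smul_le _ _).trans hp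

theorem inner_sub_eq_zero_of_isNormalTo {F : Finset (Pt d)} {n x y : Pt d}
    (hn : Mesh.IsNormalTo F n) (hx : x ∈ convexHull ℝ (F : Set (Pt d)))
    (hy : y ∈ convexHull ℝ (F : Set (Pt d))) : inner ℝ (x - y) n = 0 := by
  have hlin : IsLinearMap ℝ fun z : Pt d => inner ℝ z n :=
    ⟨fun u v => inner_add_left u v n, fun c u => real_inner_smul_left u n c⟩
  have key : ∀ b ∈ F, ∀ z ∈ convexHull ℝ (F : Set (Pt d)), inner ℝ z n = inner ℝ b n := by
    intro b hb
    refine convexHull_min (fun c hc => ?_) (convex_hyperplane hlin _)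
    have := hn c hc b hb
    rwa [inner_sub_left, sub_eq_zero] at this
  obtain ⟨b, hb⟩ : F.Nonempty := by
    rw [← Finset.coe_nonempty, ← convexHull_nonempty_iff (𝕜 := ℝ)]
    exact ⟨x, hx⟩
  rw [inner_sub_left, key b hb x hx, key b hb y hy, sub_self]

namespace Mesh

variable {Ω : Set (Pt d)} {T : Mesh Ω}

namespace Element

variable (K : T.Element)

theorem face_eq_erase {F : Finset (Pt d)} (hFK : F ⊆ K.1) (hF : F.card = d) :
    ∃ a ∈ K.1, F = K.1.erase a := by
  have h1 : (K.1 \ F).card = 1 := by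
    rw [Finset.card_sdiff_of_subset hFK, K.2.2, hF]
    omega
  obtain ⟨a, ha⟩ := Finset.card_eq_one.1 h1
  refine ⟨a, (Finset.mem_sdiff.1 (ha ▸ Finset.mem_singleton_self a)).1, ?_⟩
  rw [← Finset.sdiff_singleton_eq_erase, ← ha, Finset.sdiff_sdiff_eq_self hFK]

theorem bary_eq_zero_of_mem_face {a : Pt d} (ha : a ∈ K.1) {x : Pt d}
    (hx : x ∈ convexHull ℝ (K.1.erase a : Set (Pt d))) : K.bary a x = 0 := by
  refine convexHull_min (s := (K.1.erase a : Set (Pt d))) (t := K.bary a ⁻¹' {0}) (fun b hb => ?_)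
    ((convex_singleton 0).affine_preimage _) hx
  rw [Finset.mem_coe, Finset.mem_erase] at hb
  exact K.bary_of_ne ha hb.2 hb.1.symm

/-- In `y - x = ∑ λ_b(y) (b - x)` every vertex `b` of the face contributes a vector orthogonal to
`n`, so only `a` survives. -/
theorem inner_sub_of_isNormalTo {a n x : Pt d} (ha : a ∈ K.1)
    (hn : IsNormalTo (K.1.erase a) n) (hx : x ∈ convexHull ℝ (K.1.erase a : Set (Pt d)))
    (y : Pt d) : inner ℝ (y - x) n = K.bary a y * inner ℝ (a - x) n := by
  rw [← K.sum_bary_smul_sub y x, sum_inner, Finset.sum_eq_single a]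
  · rw [real_inner_smul_left]
  · intro b hb hba
    rw [real_inner_smul_left, inner_sub_eq_zero_of_isNormalTo hn
      (subset_convexHull ℝ _ (Finset.mem_erase.2 ⟨hba, hb⟩)) hx, mul_zero]
  · exact fun h => absurd ha h

theorem eq_zero_of_isNormalTo {n : Pt d} (hn : IsNormalTo K.1 n) : n = 0 := by
  obtain ⟨b, hb⟩ := K.vertices_nonempty
  rw [← inner_self_eq_zero (𝕜 := ℝ)]
  calc inner ℝ n n = inner ℝ (n + b - b) n := by rw [add_sub_cancel_right]
    _ = 0 := by
      rw [← K.sum_bary_smul_sub (n + b) b, sum_inner]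
      exact Finset.sum_eq_zero fun a ha => by rw [real_inner_smul_left, hn a ha b hb, mul_zero]

theorem comp_radial_eq_zero {F : Finset (Pt d)} {a n x : Pt d} (ha : a ∈ F) (hn : IsNormalTo F n)
    (hx : x ∈ convexHull ℝ (F : Set (Pt d))) (p : MvPolynomial (Fin d) ℝ) :
    comp (radial p a) n x = 0 := by
  rw [comp_radial, inner_sub_eq_zero_of_isNormalTo hn hx (subset_convexHull ℝ _ ha), mul_zero]

/-- A polynomial of degree at most `l` that is orthogonal to the divergences of the local
Raviart-Thomas fields with vanishing normal component on the boundary is constant. -/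
theorem eq_C_of_forall_bubble {l : ℕ} {w : MvPolynomial (Fin d) ℝ} (hw : w.totalDegree ≤ l)
    (h : ∀ q ∈ localRT d l, (∀ F ⊆ K.1, F.card = d → ∀ n, IsNormalTo F n →
      ∀ x ∈ convexHull ℝ (F : Set (Pt d)), comp q n x = 0) →
      ∫ x in K.hull, evalAt (polyDiv q) x * evalAt w x = 0) :
    ∃ c, w = MvPolynomial.C c := by
  -- For `l = 0` there is no room for the factor `λ_a` below, but `w` is constant already.
  rcases Nat.eq_zero_or_pos l with rfl | hl
  · exact ⟨_, MvPolynomial.totalDegree_eq_zero_iff_eq_C.1 (Nat.le_zero.1 hw)⟩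
  -- The test field is `q = ∑ λ_a (a · ∇w) (x - a)`, with the vertex `a` read as a direction. On
  -- each face either `λ_a = 0` or `x - a` is tangential.
  set r : Pt d → MvPolynomial (Fin d) ℝ := fun a => dirDeriv a w
  have hr : ∀ a, (r a).totalDegree ≤ l - 1 := fun a =>
    MvPolynomial.totalDegree_finsetSum_le fun i _ =>
      (MvPolynomial.totalDegree_mul _ _).trans (by
        rw [MvPolynomial.totalDegree_C, zero_add]
        exact (totalDegree_pderiv_le w i).trans (by omega))
  have hpt : ∀ a, (affPoly (K.bary a) * r a).totalDegree ≤ l := fun a =>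
    (MvPolynomial.totalDegree_mul _ _).trans
      ((add_le_add (totalDegree_affPoly_le _) (hr a)).trans (by omega))
  have h0 := h (∑ a ∈ K.1, radial (affPoly (K.bary a) * r a) a)
    (Submodule.sum_mem _ fun a _ => radial_mem_localRT (hpt a) a) (by
      intro F hFK hF n hn x hx
      rw [comp_sum]
      refine Finset.sum_eq_zero fun a ha => ?_
      by_cases haF : a ∈ F
      · exact comp_radial_eq_zero haF hn hx _
      · obtain ⟨a', ha', rfl⟩ := K.face_eq_erase hFK hF
        obtain rfl : a = a' := by
          by_contra hne
          exact haF (Finset.mem_erase.2 ⟨hne, ha⟩)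
        rw [comp_radial, evalAt_mul, evalAt_affPoly, K.bary_eq_zero_of_mem_face ha hx]
        simp)
  have hg : ∀ x, ∑ a ∈ K.1, K.bary a x * inner ℝ a (gradAt w x) = inner ℝ x (gradAt w x) := by
    intro x
    simp only [← real_inner_smul_left, ← sum_inner, K.sum_bary_smul]
  -- By `hg`, this is the variance of the numbers `a · ∇w(x)` under the weights `λ_a(x)`, and it
  -- equals `-q · ∇w`. Integration by parts therefore turns `∫ (div q) w` into `∫ V`.
  set V : Pt d → ℝ := fun x =>
    ∑ a ∈ K.1, K.bary a x * (inner ℝ (x - a) (gradAt w x)) ^ 2 with hV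
  have hsum : ∀ x, evalAt (polyDiv (∑ a ∈ K.1, radial (affPoly (K.bary a) * r a) a)) x *
      evalAt w x =
      (∑ a ∈ K.1, evalAt (polyDiv (radial (affPoly (K.bary a) * (r a * w)) a)) x) + V x := by
    intro x
    rw [polyDiv_sum, evalAt_sum, Finset.sum_mul, ← sub_eq_iff_eq_add', ← Finset.sum_sub_distrib]
    have e1 : ∀ a ∈ K.1, evalAt (polyDiv (radial (affPoly (K.bary a) * r a) a)) x * evalAt w x -
        evalAt (polyDiv (radial (affPoly (K.bary a) * (r a * w)) a)) x =
        K.bary a x * (inner ℝ (x - a) (gradAt w x)) ^ 2 - inner ℝ x (gradAt w x) *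
          (K.bary a x * inner ℝ x (gradAt w x) - K.bary a x * inner ℝ a (gradAt w x)) := by
      intro a _
      rw [← mul_assoc, evalAt_polyDiv_radial_mul (affPoly (K.bary a) * r a), evalAt_mul,
        evalAt_affPoly, evalAt_dirDeriv,
        inner_sub_left]
      ring
    rw [Finset.sum_congr rfl e1, Finset.sum_sub_distrib, ← Finset.mul_sum, Finset.sum_sub_distrib,
      ← Finset.sum_mul, K.sum_bary, hg]
    simp [hV]
  have hgc : Continuous fun x => gradAt w x :=
    (PiLp.continuous_toLp 2 _).comp (continuous_pi fun i => continuous_evalAt _)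
  have hVc : Continuous V := by
    refine continuous_finsetSum _ fun a _ => Continuous.mul ?_ ?_
    · exact (continuous_evalAt (affPoly (K.bary a))).congr (evalAt_affPoly _)
    · exact ((continuous_id.sub continuous_const).inner hgc).pow 2
  have hint : ∫ x in K.hull, V x = 0 := by
    simp only [hsum] at h0
    rw [integral_add (integrable_finsetSum _ fun a _ =>
      K.integrableOn_hull (continuous_evalAt _)) (K.integrableOn_hull hVc),
      integral_finsetSum _ fun a _ => K.integrableOn_hull (continuous_evalAt _),
      Finset.sum_eq_zero fun a ha => K.integral_polyDiv_bubble ha _, zero_add] at h0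
    exact h0
  have hV0 : ∀ x ∈ K.hull, ∀ a ∈ K.1, 0 ≤ K.bary a x * (inner ℝ (x - a) (gradAt w x)) ^ 2 :=
    fun x hx a ha => mul_nonneg (K.mem_hull_iff.1 hx a ha) (sq_nonneg _)
  have hVz := K.eq_zero_of_integral_eq_zero hVc
    (fun x hx => Finset.sum_nonneg (hV0 x hx)) hint
  -- Inside the element all weights are positive, so zero variance makes `∇w` orthogonal to every
  -- edge.
  have hgrad : ∀ x ∈ interior K.hull, gradAt w x = 0 := by
    intro x hx
    have hz := (Finset.sum_eq_zero_iff_of_nonneg (hV0 x (interior_subset hx))).1 (hVz x hx)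
    have hz' : ∀ a ∈ K.1, inner ℝ (x - a) (gradAt w x) = 0 := fun a ha =>
      pow_eq_zero_iff two_ne_zero |>.1
        ((mul_eq_zero.1 (hz a ha)).resolve_left (K.mem_interior_hull_iff.1 hx a ha).ne')
    refine K.eq_zero_of_isNormalTo fun a ha b hb => ?_
    rw [← sub_sub_sub_cancel_left b a x, inner_sub_left, hz' a ha, hz' b hb, sub_zero]
  refine ⟨_, eq_C_of_pderiv_eq_zero fun i => ?_⟩
  refine eq_zero_of_evalAt_eq_zero isOpen_interior K.interior_hull_nonempty fun x hx => ?_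
  exact congrArg (fun v : Pt d => v i) (hgrad x hx)

end Element

end Mesh

end

/-! ### Connectivity through faces and the geometry of neighbouring elements -/

section

/-- Labels on a finite closed cover of a preconnected set that agree on intersecting members
agree on all members that meet the set. -/
theorem label_eq_of_isPreconnected {X ι α : Type*} [TopologicalSpace X] [Finite ι] {P : Set X}
    (hP : IsPreconnected P) {C : ι → Set X} (hC : ∀ i, IsClosed (C i)) (hcov : P ⊆ ⋃ i, C i)
    {lab : ι → α} (h : ∀ i j, ∀ x ∈ P, x ∈ C i → x ∈ C j → lab i = lab j) {i j : ι}
    (hi : (P ∩ C i).Nonempty) (hj : (P ∩ C j).Nonempty) : lab i = lab j := by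
  by_contra hne
  -- The members labelled like `C i` and the remaining ones have closed unions covering `P`; a
  -- common point contradicts `h`.
  obtain ⟨x, hxP, hxA, hxB⟩ := isPreconnected_closed_iff.1 hP
    (⋃ k ∈ {k | lab k = lab i}, C k) (⋃ k ∈ {k | lab k ≠ lab i}, C k)
    (Set.Finite.isClosed_biUnion (Set.toFinite _) fun k _ => hC k)
    (Set.Finite.isClosed_biUnion (Set.toFinite _) fun k _ => hC k)
    (fun x hx => by
      obtain ⟨k, hk⟩ := Set.mem_iUnion.1 (hcov hx)
      by_cases hki : lab k = lab i
      · exact Or.inl (Set.mem_biUnion (show k ∈ {k | lab k = lab i} from hki) hk)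
      · exact Or.inr (Set.mem_biUnion (show k ∈ {k | lab k ≠ lab i} from hki) hk))
    (hi.mono fun x hx => ⟨hx.1, Set.mem_biUnion (show i ∈ {k | lab k = lab i} from rfl) hx.2⟩)
    (hj.mono fun x hx =>
      ⟨hx.1, Set.mem_biUnion (show j ∈ {k | lab k ≠ lab i} from fun e => hne e.symm) hx.2⟩)
  simp only [Set.mem_iUnion] at hxA hxB
  obtain ⟨k, hk, hxk⟩ := hxA
  obtain ⟨m, hm, hxm⟩ := hxB
  exact hm ((h m k x hxP hxm hxk).trans hk)

variable {d : ℕ}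

theorem volume_affineSpan_eq_zero (G : Finset (Pt d)) (hG : G.card ≤ d) :
    volume (affineSpan ℝ (G : Set (Pt d)) : Set (Pt d)) = 0 := by
  refine Measure.addHaar_affineSubspace _ _ fun htop => ?_
  rcases G.eq_empty_or_nonempty with rfl | hne
  · simp only [Finset.coe_empty, AffineSubspace.span_empty] at htop
    exact AffineSubspace.bot_ne_top ℝ (Pt d) (Pt d) htop
  · have h1 : (vectorSpan ℝ (G : Set (Pt d))) = ⊤ := by
      rw [← direction_affineSpan, htop, AffineSubspace.direction_top]
    have hpos := hne.card_pos
    have h2 := finrank_vectorSpan_image_finset_le ℝ (id : Pt d → Pt d) G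
      (n := G.card - 1) (by omega)
    rw [Finset.image_id, h1, finrank_top, finrank_euclideanSpace, Fintype.card_fin] at h2
    omega

theorem exists_mem_notMem_affineSpan {U : Set (Pt d)} (hU : IsOpen U) (hne : U.Nonempty)
    {𝓕 : Set (Finset (Pt d))} (hfin : 𝓕.Finite) (hcard : ∀ G ∈ 𝓕, G.card ≤ d) :
    ∃ x ∈ U, ∀ G ∈ 𝓕, x ∉ affineSpan ℝ (G : Set (Pt d)) := by
  have hnull : volume (⋃ G ∈ 𝓕, (affineSpan ℝ (G : Set (Pt d)) : Set (Pt d))) = 0 :=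
    (measure_biUnion_null_iff hfin.countable).2 fun G hG => volume_affineSpan_eq_zero G (hcard G hG)
  obtain ⟨x, hxU, hx⟩ := nonempty_of_measure_ne_zero
    (s := U \ ⋃ G ∈ 𝓕, (affineSpan ℝ (G : Set (Pt d)) : Set (Pt d)))
    (μ := (volume : Measure (Pt d)))
    (by rw [measure_sdiff_null hnull]; exact (hU.measure_pos _ hne).ne')
  exact ⟨x, hxU, fun G hG hxG => hx (Set.mem_biUnion hG hxG)⟩

namespace Mesh

variable {Ω : Set (Pt d)} {T : Mesh Ω}

theorem closure_eq_iUnion_hull (T : Mesh Ω) : closure Ω = ⋃ K : T.Element, K.hull := by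
  refine Set.Subset.antisymm (fun x hx => ?_) (Set.iUnion_subset fun K => K.hull_subset_closure)
  rw [← T.space_eq, Geometry.SimplicialComplex.mem_space_iff] at hx
  obtain ⟨s, hs, hxs⟩ := hx
  obtain ⟨K, hK, hcard, hsK⟩ := T.pure s hs
  exact Set.mem_iUnion.2 ⟨⟨K, hK, hcard⟩, convexHull_mono (Finset.coe_subset.2 hsK) hxs⟩

theorem exists_element_of_mem_facesIn {S : Set (Pt d)} {F : Finset (Pt d)} (hF : F ∈ T.facesIn S) :
    ∃ K : T.Element, F ⊆ K.1 := by
  obtain ⟨K, hK, hcard, hFK⟩ := T.pure F hF.1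
  exact ⟨⟨K, hK, hcard⟩, hFK⟩

/-- Data that agree on elements sharing a face are constant on the mesh of a convex domain. -/
theorem eq_of_eq_of_shared_face {α : Type*} (hconv : Convex ℝ Ω) (lab : T.Element → α)
    (h : ∀ (K K' : T.Element) (F : Finset (Pt d)), F.card = d → F ⊆ K.1 → F ⊆ K'.1 →
      lab K = lab K') (K K' : T.Element) : lab K = lab K' := by
  classical
  have hfin : {F | F ∈ T.faces ∧ F.card < d}.Finite := T.finite_faces.subset fun F hF => hF.1
  obtain ⟨x, hxK, hx⟩ := exists_mem_notMem_affineSpan isOpen_interior K.interior_hull_nonempty hfin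
    fun F hF => hF.2.le
  -- Adding `x` to a face with fewer than `d` vertices gives at most `d` points, whose span is null.
  -- A generic `y` makes the segment from `x` miss all these faces.
  obtain ⟨y, hyK, hy⟩ := exists_mem_notMem_affineSpan isOpen_interior K'.interior_hull_nonempty
    (hfin.image fun F => insert x F) (by
      rintro _ ⟨F, hF, rfl⟩
      exact (Finset.card_insert_le _ _).trans hF.2)
  have havoid : ∀ F ∈ T.faces, F.card < d → ∀ z ∈ segment ℝ x y,
      z ∉ convexHull ℝ (F : Set (Pt d)) := by
    intro F hF hFd z hz hzF
    have hzs : z ∈ affineSpan ℝ (F : Set (Pt d)) := convexHull_subset_affineSpan _ hzF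
    rw [segment_eq_image_lineMap] at hz
    obtain ⟨s, -, rfl⟩ := hz
    by_cases hs : s = 0
    · rw [hs, AffineMap.lineMap_apply_zero] at hzs
      exact hx F ⟨hF, hFd⟩ hzs
    · refine hy (insert x F) ⟨F, ⟨hF, hFd⟩, rfl⟩ ?_
      rw [Finset.coe_insert]
      have h1 : AffineMap.lineMap x y s ∈ affineSpan ℝ (insert x (F : Set (Pt d))) :=
        affineSpan_mono ℝ (Set.subset_insert _ _) hzs
      have h2 : x ∈ affineSpan ℝ (insert x (F : Set (Pt d))) :=
        subset_affineSpan ℝ _ (Set.mem_insert _ _)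
      have h3 := AffineMap.lineMap_mem s⁻¹ h2 h1
      rwa [AffineMap.lineMap_lineMap_right, inv_mul_cancel₀ hs, AffineMap.lineMap_apply_one] at h3
  have hsub : segment ℝ x y ⊆ closure Ω := hconv.closure.segment_subset
    (K.hull_subset_closure (interior_subset hxK)) (K'.hull_subset_closure (interior_subset hyK))
  refine label_eq_of_isPreconnected (convex_segment x y).isPreconnected
    (C := fun K : T.Element => K.hull) (fun K => K.isCompact_hull.isClosed)
    (by rwa [T.closure_eq_iUnion_hull] at hsub) (fun K₁ K₂ z hz h₁ h₂ => ?_)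
    ⟨x, left_mem_segment ℝ x y, interior_subset hxK⟩
    ⟨y, right_mem_segment ℝ x y, interior_subset hyK⟩
  by_cases hne : K₁ = K₂
  · rw [hne]
  have hzI : z ∈ convexHull ℝ ((K₁.1 ∩ K₂.1 : Finset (Pt d)) : Set (Pt d)) := by
    rw [Finset.coe_inter]
    exact T.inter_subset_convexHull K₁.2.1 K₂.2.1 ⟨h₁, h₂⟩
  have hIne : (K₁.1 ∩ K₂.1).Nonempty := by
    rw [← Finset.coe_nonempty, ← convexHull_nonempty_iff (𝕜 := ℝ)]
    exact ⟨z, hzI⟩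
  have hface := T.toSimplicialComplex.down_closed K₁.2.1 Finset.inter_subset_left hIne
  -- Elements meeting on the segment meet in a common face that the segment does not avoid, so they
  -- share at least `d` vertices.
  have hge : d ≤ (K₁.1 ∩ K₂.1).card := by
    by_contra! hlt
    exact havoid _ hface hlt z hz hzI
  refine h K₁ K₂ (K₁.1 ∩ K₂.1) (le_antisymm ?_ hge) Finset.inter_subset_left
    Finset.inter_subset_right
  by_contra! hlt
  refine hne (Subtype.ext ?_)
  have e1 := Finset.eq_of_subset_of_card_le (Finset.inter_subset_left (s₁ := K₁.1) (s₂ := K₂.1))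
    (by rw [K₁.2.2]; omega)
  have e2 := Finset.eq_of_subset_of_card_le (Finset.inter_subset_right (s₁ := K₁.1) (s₂ := K₂.1))
    (by rw [K₂.2.2]; omega)
  exact e1.symm.trans e2

namespace Element

theorem ext_of_subset {K K' : T.Element} (h : K.1 ⊆ K'.1) : K = K' :=
  Subtype.ext (Finset.eq_of_subset_of_card_le h (by rw [K.2.2, K'.2.2]))

variable (K : T.Element)

theorem map_eq_sum_bary (φ : Pt d →ᵃ[ℝ] ℝ) (y : Pt d) : φ y = ∑ b ∈ K.1, K.bary b y * φ b := by
  have hφ : ∀ z, φ z = φ.linear z + φ 0 := fun z => congrFun φ.decomp z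
  rw [hφ y, Finset.sum_congr rfl fun b _ => by rw [hφ b, mul_add], Finset.sum_add_distrib,
    ← Finset.sum_mul, K.sum_bary, one_mul]
  congr 1
  conv_lhs => rw [← K.sum_bary_smul y]
  simp

theorem mem_face_of_bary_eq_zero {a x : Pt d} (hx : x ∈ K.hull) (h0 : K.bary a x = 0) :
    x ∈ convexHull ℝ (K.1.erase a : Set (Pt d)) := by
  classical
  rw [K.mem_hull_iff] at hx
  have h1 : ∑ b ∈ K.1.erase a, K.bary b x = 1 := by
    rw [← K.sum_bary x]
    exact Finset.sum_erase _ h0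
  have h2 : ∑ b ∈ K.1.erase a, K.bary b x • b = x := by
    conv_rhs => rw [← K.sum_bary_smul x]
    exact Finset.sum_erase _ (by rw [h0, zero_smul])
  rw [← h2]
  exact (convex_convexHull ℝ _).sum_mem (fun b hb => hx b (Finset.mem_of_mem_erase hb)) h1
    fun b hb => subset_convexHull ℝ _ hb

/-- An interior point is projected from `a` onto the opposite face; the factor `(1 - λ_a(x))⁻¹` is
the one that brings `λ_a` to zero. -/
theorem exists_mem_face_interior (hd : 0 < d) {a : Pt d} (ha : a ∈ K.1) :
    ∃ m ∈ convexHull ℝ (K.1.erase a : Set (Pt d)),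
      K.bary a m = 0 ∧ ∀ b ∈ K.1, b ≠ a → 0 < K.bary b m := by
  classical
  obtain ⟨x, hx⟩ := K.interior_hull_nonempty
  rw [K.mem_interior_hull_iff] at hx
  have hlt : 0 < 1 - K.bary a x := by
    rw [← K.sum_bary x, ← Finset.add_sum_erase _ _ ha, add_sub_cancel_left]
    refine Finset.sum_pos (fun b hb => hx b (Finset.mem_of_mem_erase hb)) ?_
    rw [← Finset.card_pos, Finset.card_erase_of_mem ha, K.2.2]
    exact hd
  set m := a + (1 - K.bary a x)⁻¹ • (x - a) with hm
  have hma : K.bary a m = 0 := by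
    rw [hm, K.bary_line, K.bary_self ha]
    field_simp
    ring
  have hmb : ∀ b ∈ K.1, b ≠ a → 0 < K.bary b m := fun b hb hba => by
    rw [hm, K.bary_line, K.bary_of_ne hb ha hba, mul_zero, zero_add]
    exact mul_pos (inv_pos.2 hlt) (hx b hb)
  refine ⟨m, K.mem_face_of_bary_eq_zero (K.mem_hull_iff.2 fun b hb => ?_) hma, hma, hmb⟩
  by_cases hba : b = a
  · rw [hba, hma]
  · exact (hmb b hb hba).le

variable {K}

/-- The vertices opposite to a shared face lie on opposite sides of the face. -/
theorem bary_opposite_neg (hd : 0 < d) {K' : T.Element} (hne : K ≠ K') {a a' : Pt d}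
    (ha : a ∈ K.1) (ha' : a' ∈ K'.1) (h : K.1.erase a = K'.1.erase a') : K.bary a a' < 0 := by
  classical
  by_contra! hnn
  obtain ⟨m, hmF, hma, hmb⟩ := K.exists_mem_face_interior hd ha
  -- If `λ_a(a') ≥ 0`, a small step from `m` towards `a'` stays in both elements. By conformity the
  -- point lies in the shared face, yet its coordinate at `a'` in `K'` is `ε > 0`.
  have hε : ∀ᶠ ε : ℝ in 𝓝[>] 0, ∀ b ∈ K.1, 0 ≤ K.bary b (m + ε • (a' - m)) := by
    refine (Finset.eventually_all K.1).2 fun b hb => ?_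
    by_cases hba : b = a
    · filter_upwards [self_mem_nhdsWithin] with ε (hε : 0 < ε)
      rw [hba, K.bary_line, hma, mul_zero, zero_add]
      exact mul_nonneg hε.le hnn
    · have hlim : Tendsto (fun ε : ℝ => K.bary b (m + ε • (a' - m))) (𝓝[>] 0) (𝓝 (K.bary b m)) := by
        have : Continuous fun ε : ℝ => (1 - ε) * K.bary b m + ε * K.bary b a' := by fun_prop
        simp_rw [K.bary_line]
        simpa using (this.tendsto 0).mono_left nhdsWithin_le_nhds
      exact (hlim.eventually (lt_mem_nhds (hmb b hb hba))).mono fun _ h => h.le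
  obtain ⟨ε, hεK, hε0, hε1⟩ :=
    (hε.and (Ioo_mem_nhdsGT (show (0 : ℝ) < 1 by norm_num))).exists
  have hmF' : m ∈ convexHull ℝ (K'.1.erase a' : Set (Pt d)) := h ▸ hmF
  have hzK' : m + ε • (a' - m) ∈ K'.hull := by
    have hmK' : m ∈ K'.hull :=
      convexHull_mono (Finset.coe_subset.2 (Finset.erase_subset _ _)) hmF'
    exact (convex_convexHull ℝ _).add_smul_sub_mem hmK' (K'.subset_hull ha') ⟨hε0.le, hε1.le⟩
  have hzI := T.inter_subset_convexHull K.2.1 K'.2.1 ⟨K.mem_hull_iff.2 hεK, hzK'⟩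
  have hsub : (K.1 : Set (Pt d)) ∩ K'.1 ⊆ (K'.1.erase a' : Set (Pt d)) := by
    rintro b ⟨hb, hb'⟩
    refine Finset.mem_coe.2 (Finset.mem_erase.2 ⟨?_, hb'⟩)
    rintro rfl
    refine hne (ext_of_subset fun c hc => ?_)
    by_cases hca : c = a
    · have : b ∉ K.1.erase a := h ▸ Finset.notMem_erase _ _
      obtain rfl : b = a := by
        by_contra hba
        exact this (Finset.mem_erase.2 ⟨hba, hb⟩)
      exact hca ▸ hb'
    · exact Finset.mem_of_mem_erase (h ▸ Finset.mem_erase.2 ⟨hca, hc⟩ : c ∈ K'.1.erase b)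
  have h1 := K'.bary_eq_zero_of_mem_face ha' (convexHull_mono hsub hzI)
  rw [K'.bary_line, K'.bary_eq_zero_of_mem_face ha' hmF', K'.bary_self ha'] at h1
  linarith

/-- A face belongs to at most two elements. -/
theorem eq_or_eq_of_face (hd : 0 < d) {K' K'' : T.Element} (hne : K ≠ K') {a a' a'' : Pt d}
    (ha : a ∈ K.1) (ha' : a' ∈ K'.1) (ha'' : a'' ∈ K''.1) (h : K.1.erase a = K'.1.erase a')
    (h' : K.1.erase a = K''.1.erase a'') : K'' = K ∨ K'' = K' := by
  classical
  by_contra! hcon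
  have h1 := bary_opposite_neg hd hne ha ha' h
  have h2 := bary_opposite_neg hd hcon.1.symm ha ha'' h'
  have h3 := bary_opposite_neg hd hcon.2.symm ha' ha'' (h.symm.trans h')
  -- Since `λ_a` vanishes on the shared face, `λ_a(a'') = λ'_{a'}(a'') λ_a(a')`: a product of two
  -- negative numbers, though `λ_a(a'')` must be negative.
  have h4 := K'.map_eq_sum_bary (K.bary a) a''
  rw [Finset.sum_eq_single a' (fun b hb hba => by
    have : b ∈ K.1.erase a := h ▸ Finset.mem_erase.2 ⟨hba, hb⟩
    rw [Finset.mem_erase] at this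
    rw [K.bary_of_ne ha this.2 this.1.symm, mul_zero]) (fun hn => absurd ha' hn)] at h4
  have := mul_pos_of_neg_of_neg h3 h1
  linarith

/-- A face on the boundary belongs to only one element. -/
theorem eq_of_boundary_face (hd : 0 < d) (hopen : IsOpen Ω) (hconv : Convex ℝ Ω)
    (hΩ : Ω.Nonempty) {K' : T.Element} {F : Finset (Pt d)} (hF : F.card = d)
    (hb : convexHull ℝ (F : Set (Pt d)) ⊆ frontier Ω) (hK : F ⊆ K.1) (hK' : F ⊆ K'.1) :
    K = K' := by
  classical
  by_contra hne
  obtain ⟨a, ha, rfl⟩ := K.face_eq_erase hK hF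
  obtain ⟨a', ha', heq⟩ := K'.face_eq_erase hK' hF
  have hneg := bary_opposite_neg hd hne ha ha' heq
  obtain ⟨m, hmF, hma, hmb⟩ := K.exists_mem_face_interior hd ha
  have hmΩ : m ∉ Ω := by
    have := hb hmF
    rw [hopen.frontier_eq] at this
    exact this.2
  -- A functional supporting `Ω` at `m` is constant on the face, as `m` is a positive combination of
  -- its vertices. Thus `f - f m` is a negative multiple of `λ_a`, hence positive at `a'`, which is
  -- impossible in `closure Ω`.
  obtain ⟨f, hf⟩ := geometric_hahn_banach_open_point hconv hopen hmΩ
  have hcl : ∀ y ∈ closure Ω, f y ≤ f m := fun y hy =>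
    closure_minimal (fun z hz => (hf z hz).le) (isClosed_le f.continuous continuous_const) hy
  have hsum : ∀ y, f y - f m = ∑ b ∈ K.1, K.bary b y * (f b - f m) := fun y => by
    have := congrArg f (K.sum_bary_smul_sub y m)
    simp only [map_sum, map_smul, map_sub, smul_eq_mul] at this
    exact this.symm
  have hle : ∀ b ∈ K.1, f b - f m ≤ 0 := fun b hb =>
    sub_nonpos.2 (hcl b (K.hull_subset_closure (K.subset_hull hb)))
  have hnnm : ∀ b ∈ K.1, 0 ≤ K.bary b m := fun b hb => by
    by_cases hba : b = a
    · rw [hba, hma]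
    · exact (hmb b hb hba).le
  have hz : ∀ b ∈ K.1, b ≠ a → f b - f m = 0 := by
    intro b hb hba
    have h0 := hsum m
    rw [sub_self] at h0
    have := (Finset.sum_eq_zero_iff_of_nonpos fun c hc =>
      mul_nonpos_of_nonneg_of_nonpos (hnnm c hc) (hle c hc)).1 h0.symm b hb
    exact (mul_eq_zero.1 this).resolve_left (hmb b hb hba).ne'
  have hsum' : ∀ y, f y - f m = K.bary a y * (f a - f m) := fun y => by
    rw [hsum y]
    exact Finset.sum_eq_single a (fun b hb hba => by rw [hz b hb hba, mul_zero])
      (fun h => absurd ha h)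
  obtain ⟨y, hy⟩ := hΩ
  have hfa : f a - f m ≠ 0 := by
    intro h0
    have := hsum' y
    rw [h0, mul_zero] at this
    linarith [hf y hy]
  have h1 := hsum' a'
  have h2 := hcl a' (K'.hull_subset_closure (K'.subset_hull ha'))
  have h3 := mul_pos_of_neg_of_neg hneg ((hle a ha).lt_of_ne hfa)
  linarith

open scoped Pointwise in
/-- The ratio of the volumes of two elements that share a face. -/
theorem volume_hull_opposite {K' : T.Element} {a a' : Pt d}
    (ha : a ∈ K.1) (ha' : a' ∈ K'.1) (h : K.1.erase a = K'.1.erase a') :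
    volume.real K'.hull = |K.bary a a'| * volume.real K.hull := by
  classical
  set φ := K.bary a with hφ
  -- This map fixes the shared face and sends `a` to `a'`. Its linear part is a transvection with
  -- determinant `1 + (λ_a(a') - λ_a(a)) = λ_a(a')`.
  let Ψ : Pt d →ᵃ[ℝ] Pt d :=
    AffineMap.id ℝ (Pt d) + (LinearMap.toSpanSingleton ℝ (Pt d) (a' - a)).toAffineMap.comp φ
  have hΨ : ∀ y, Ψ y = y + φ y • (a' - a) := fun y => by simp [Ψ]
  have himg : Ψ '' K.hull = K'.hull := by
    rw [hull, hull, AffineMap.image_convexHull]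
    congr 1
    rw [← Finset.insert_erase ha, ← Finset.insert_erase ha', ← h]
    rw [Finset.coe_insert, Finset.coe_insert, Set.image_insert_eq]
    congr 1
    · rw [hΨ, hφ, K.bary_self ha]
      simp
    · have hid : ∀ b ∈ (K.1.erase a : Set (Pt d)), Ψ b = b := fun b hb => by
        rw [Finset.mem_coe, Finset.mem_erase] at hb
        rw [hΨ, hφ, K.bary_of_ne ha hb.2 hb.1.symm, zero_smul, add_zero]
      rw [Set.image_congr hid, Set.image_id']
  have hφl : ∀ z, φ z = φ.linear z + φ 0 := fun z => congrFun φ.decomp z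
  have himg2 : K'.hull =
      (φ 0 • (a' - a)) +ᵥ ((LinearMap.transvection φ.linear (a' - a)) '' K.hull) := by
    rw [← himg, ← Set.image_vadd, Set.image_image]
    refine Set.image_congr fun y _ => ?_
    rw [hΨ, LinearMap.transvection.apply, hφl y, vadd_eq_add, add_smul]
    abel
  have hdet : (LinearMap.transvection φ.linear (a' - a)).det = φ a' := by
    rw [LinearMap.transvection.det]
    have := φ.linearMap_vsub a' a
    simp only [vsub_eq_sub] at this
    rw [this, hφ, K.bary_self ha]
    ring
  rw [himg2, Measure.real, measure_vadd, Measure.addHaar_image_linearMap, hdet, ENNReal.toReal_mul,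
    ENNReal.toReal_ofReal (abs_nonneg _)]
  rfl

end Element

end Mesh

end

/-! ### Surjectivity of the divergence on `D_0^l` -/

section

variable {d : ℕ}

namespace Mesh

variable {Ω : Set (Pt d)} {T : Mesh Ω} {S : Set (Pt d)}

theorem IsOuterUnitNormal.isNormalTo {F : Finset (Pt d)} {ν : Pt d} (h : IsOuterUnitNormal Ω F ν)
    (hF : convexHull ℝ (F : Set (Pt d)) ⊆ closure Ω) : IsNormalTo F ν := by
  have hcl : ∀ x ∈ F, ∀ y ∈ F, inner ℝ (y - x) ν ≤ 0 := fun x hx y hy =>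
    closure_minimal (t := {y | inner ℝ (y - x) ν ≤ 0})
      (fun z hz => h.2 x (subset_convexHull ℝ _ hx) z hz)
      (isClosed_le (by fun_prop) continuous_const) (hF (subset_convexHull ℝ _ hy))
  intro a ha b hb
  refine le_antisymm (hcl b hb a ha) ?_
  have := hcl a ha b hb
  rw [← neg_sub, inner_neg_left] at this
  linarith

theorem hull_subset_frontier (hS : S ⊆ frontier Ω) {F : Finset (Pt d)} (hF : F ∈ T.facesIn S) :
    convexHull ℝ (F : Set (Pt d)) ⊆ frontier Ω :=
  hF.2.2.trans hS

theorem mem_D_zero {l : ℕ} (hS : S ⊆ frontier Ω) {q : T.VField} (hloc : ∀ K, q K ∈ localRT d l)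
    (hcont : ∀ K K' : T.Element, ∀ F : Finset (Pt d), F.card = d → F ⊆ K.1 → F ⊆ K'.1 →
      ∀ n, IsNormalTo F n → ∀ x ∈ convexHull ℝ (F : Set (Pt d)), comp (q K) n x = comp (q K') n x)
    (htr : ∀ F ∈ T.facesIn S, ∀ K : T.Element, F ⊆ K.1 → ∀ n, IsNormalTo F n →
      ∀ x ∈ convexHull ℝ (F : Set (Pt d)), comp (q K) n x = 0) : q ∈ T.D l S 0 := by
  refine ⟨⟨hloc, hcont⟩, fun F hF K hK ν hν x hx => ?_⟩
  rw [htr F hF K hK ν (hν.isNormalTo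
    ((hull_subset_frontier hS hF).trans frontier_subset_closure)) x hx]
  simp

section InfSup

theorem polyDiv_zero : polyDiv (0 : Fin d → MvPolynomial (Fin d) ℝ) = 0 := by
  simp [polyDiv]

theorem integral_polyDiv_radial_C (K : T.Element) (c e : ℝ) (a : Pt d) :
    ∫ x in K.hull, evalAt (polyDiv (radial (MvPolynomial.C c) a)) x * evalAt (MvPolynomial.C e) x =
      d * c * e * volume.real K.hull := by
  simp [evalAt_polyDiv_radial]
  ring

variable {l : ℕ} {w : T.Scalar}

/-- A local field with zero normal trace on the boundary of its element extends by zero to `D_0^l`,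
so the elementwise criterion applies. -/
theorem eq_C_of_orthogonal (hS : S ⊆ frontier Ω) (hw : w ∈ T.X l)
    (h : ∀ q ∈ T.D l S 0, l2 (div q) w = 0) (K : T.Element) : ∃ c, w K = MvPolynomial.C c := by
  classical
  refine K.eq_C_of_forall_bubble (hw K) fun q hq hq0 => ?_
  have hval : ∀ (K' : T.Element) (F : Finset (Pt d)), F ⊆ K'.1 → F.card = d → ∀ n, IsNormalTo F n →
      ∀ x ∈ convexHull ℝ (F : Set (Pt d)), comp ((Pi.single K q : T.VField) K') n x = 0 := by
    intro K' F hF hFd n hn x hx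
    by_cases hK : K' = K
    · subst hK
      rw [Pi.single_eq_same]
      exact hq0 F hF hFd n hn x hx
    · rw [Pi.single_eq_of_ne hK]
      exact comp_zero n x
  have hmem : (Pi.single K q : T.VField) ∈ T.D l S 0 := by
    refine mem_D_zero hS (fun K' => ?_) (fun K₁ K₂ F hF h₁ h₂ n hn x hx => ?_)
      fun F hF K' hK' => hval K' F hK' hF.2.1
    · by_cases hK : K' = K
      · subst hK
        rwa [Pi.single_eq_same]
      · rw [Pi.single_eq_of_ne hK]
        exact zero_mem _
    · rw [hval K₁ F h₁ hF n hn x hx, hval K₂ F h₂ hF n hn x hx]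
  have h0 := h _ hmem
  rw [l2, Finset.sum_eq_single K (fun K' _ hK' => ?_) (fun hn => absurd (Finset.mem_univ _) hn)]
    at h0
  · change ∫ x in K.hull, evalAt (polyDiv ((Pi.single K q : T.VField) K)) x * _ = 0 at h0
    rwa [Pi.single_eq_same] at h0
  · change ∫ x in K'.hull, evalAt (polyDiv ((Pi.single K q : T.VField) K')) x * _ = 0
    rw [Pi.single_eq_of_ne hK', polyDiv_zero]
    simp

/-- A lowest order field supported on the two elements, with normal flux only through their common
face, has opposite total divergences on them; testing with it equates the constants. -/
theorem const_eq_of_shared_face (hd : 0 < d) (hopen : IsOpen Ω) (hconv : Convex ℝ Ω)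
    (hΩ : Ω.Nonempty) (hS : S ⊆ frontier Ω) (h : ∀ q ∈ T.D l S 0, l2 (div q) w = 0)
    {c : T.Element → ℝ} (hc : ∀ K, w K = MvPolynomial.C (c K)) {K K' : T.Element}
    {F : Finset (Pt d)} (hF : F.card = d) (hK : F ⊆ K.1) (hK' : F ⊆ K'.1) : c K = c K' := by
  classical
  by_cases hne : K = K'
  · rw [hne]
  obtain ⟨a, ha, rfl⟩ := K.face_eq_erase hK hF
  obtain ⟨a', ha', heq⟩ := K'.face_eq_erase hK' hF
  set t := K.bary a a' with ht
  have hneg : t < 0 := Element.bary_opposite_neg hd hne ha ha' heq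
  -- The factor `t = λ_a(a')` matches the normal components, because `(a' - x) · n = t (a - x) · n`
  -- on the face.
  let q : T.VField := fun E =>
    if E = K then radial (MvPolynomial.C t) a
    else if E = K' then radial (MvPolynomial.C 1) a' else 0
  have hqK : q K = radial (MvPolynomial.C t) a := if_pos rfl
  have hqK' : q K' = radial (MvPolynomial.C 1) a' := by simp only [q, if_neg (Ne.symm hne), if_true]
  have hq0 : ∀ E, E ≠ K → E ≠ K' → q E = 0 := fun E h1 h2 => by simp only [q, if_neg h1, if_neg h2]
  have hoff : ∀ (E : T.Element) (G : Finset (Pt d)), G.card = d → G ⊆ E.1 → G ≠ K.1.erase a →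
      ∀ n, IsNormalTo G n → ∀ x ∈ convexHull ℝ (G : Set (Pt d)), comp (q E) n x = 0 := by
    intro E G hG hGE hGne n hn x hx
    obtain ⟨b, hb, rfl⟩ := E.face_eq_erase hGE hG
    by_cases h1 : E = K
    · subst h1
      rw [hqK]
      refine Element.comp_radial_eq_zero (Finset.mem_erase.2 ⟨?_, ha⟩) hn hx _
      rintro rfl
      exact hGne rfl
    · by_cases h2 : E = K'
      · subst h2
        rw [hqK']
        refine Element.comp_radial_eq_zero (Finset.mem_erase.2 ⟨?_, ha'⟩) hn hx _
        rintro rfl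
        exact hGne heq.symm
      · rw [hq0 E h1 h2]
        exact comp_zero n x
  have hon : ∀ (E : T.Element), K.1.erase a ⊆ E.1 → ∀ n, IsNormalTo (K.1.erase a) n →
      ∀ x ∈ convexHull ℝ (K.1.erase a : Set (Pt d)), comp (q E) n x = t * inner ℝ (x - a) n := by
    intro E hE n hn x hx
    obtain ⟨a'', ha'', heq'⟩ := E.face_eq_erase hE hF
    rcases Element.eq_or_eq_of_face hd hne ha ha' ha'' heq heq' with rfl | rfl
    · rw [hqK, comp_radial, evalAt_C]
    · rw [hqK', comp_radial, evalAt_C, one_mul, ← neg_sub a' x, ← neg_sub a x, inner_neg_left,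
        inner_neg_left, K.inner_sub_of_isNormalTo ha hn hx a']
      ring
  have hmem : q ∈ T.D l S 0 := by
    refine mem_D_zero hS (fun E => ?_) (fun K₁ K₂ G hG h₁ h₂ n hn x hx => ?_)
      (fun G hG E hE n hn x hx => ?_)
    · by_cases h1 : E = K
      · rw [h1, hqK]
        exact radial_mem_localRT (by simp) _
      · by_cases h2 : E = K'
        · rw [h2, hqK']
          exact radial_mem_localRT (by simp) _
        · rw [hq0 E h1 h2]
          exact zero_mem _
    · by_cases hGF : G = K.1.erase a
      · subst hGF
        rw [hon K₁ h₁ n hn x hx, hon K₂ h₂ n hn x hx]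
      · rw [hoff K₁ G hG h₁ hGF n hn x hx, hoff K₂ G hG h₂ hGF n hn x hx]
    · refine hoff E G hG.2.1 hE (fun hGF => hne ?_) n hn x hx
      subst hGF
      exact Element.eq_of_boundary_face hd hopen hconv hΩ hF (hull_subset_frontier hS hG) hK hK'
  have h0 := h q hmem
  rw [l2, Finset.sum_eq_add K K' hne (fun E _ hE => ?_)
    (fun hn => absurd (Finset.mem_univ _) hn) (fun hn => absurd (Finset.mem_univ _) hn)] at h0
  · change (∫ x in K.hull, evalAt (polyDiv (q K)) x * _) +
      (∫ x in K'.hull, evalAt (polyDiv (q K')) x * _) = 0 at h0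
    rw [hqK, hqK', hc, hc, integral_polyDiv_radial_C, integral_polyDiv_radial_C,
      Element.volume_hull_opposite ha ha' heq, ← ht, abs_of_neg hneg] at h0
    -- As `|K'| = -t |K|`, the two contributions combine to `d t |K| (c K - c K')`.
    have hne0 : (d : ℝ) * t * volume.real K.hull ≠ 0 :=
      mul_ne_zero (mul_ne_zero (Nat.cast_ne_zero.2 hd.ne') hneg.ne) K.volume_hull_pos.ne'
    have h1 : (d : ℝ) * t * volume.real K.hull * (c K - c K') = 0 := by linarith
    exact sub_eq_zero.1 ((mul_eq_zero.1 h1).resolve_left hne0)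
  · change ∫ x in E.hull, evalAt (polyDiv (q E)) x * _ = 0
    rw [hq0 E hE.1 hE.2, polyDiv_zero]
    simp

/-- The field `x - a` on `K` alone has normal flux only through the free face and has divergence
`d`. -/
theorem const_eq_zero_of_free_face (hd : 0 < d) (hopen : IsOpen Ω) (hconv : Convex ℝ Ω)
    (hΩ : Ω.Nonempty) (hS : S ⊆ frontier Ω) (h : ∀ q ∈ T.D l S 0, l2 (div q) w = 0)
    {c : T.Element → ℝ} (hc : ∀ K, w K = MvPolynomial.C (c K)) {K : T.Element}
    {F : Finset (Pt d)} (hF : F ∈ T.facesIn (frontier Ω)) (hFS : F ∉ T.facesIn S)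
    (hK : F ⊆ K.1) : c K = 0 := by
  classical
  obtain ⟨a, ha, rfl⟩ := K.face_eq_erase hK hF.2.1
  set q : T.VField := Pi.single K (radial (MvPolynomial.C 1) a) with hq
  have hqK : q K = radial (MvPolynomial.C 1) a := Pi.single_eq_same _ _
  have hq0 : ∀ E, E ≠ K → q E = 0 := fun E hE => Pi.single_eq_of_ne hE _
  have hoff : ∀ (E : T.Element) (G : Finset (Pt d)), G.card = d → G ⊆ E.1 → G ≠ K.1.erase a →
      ∀ n, IsNormalTo G n → ∀ x ∈ convexHull ℝ (G : Set (Pt d)), comp (q E) n x = 0 := by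
    intro E G hG hGE hGne n hn x hx
    by_cases h1 : E = K
    · subst h1
      obtain ⟨b, hb, rfl⟩ := E.face_eq_erase hGE hG
      rw [hqK]
      refine Element.comp_radial_eq_zero (Finset.mem_erase.2 ⟨?_, ha⟩) hn hx _
      rintro rfl
      exact hGne rfl
    · rw [hq0 E h1]
      exact comp_zero n x
  have hmem : q ∈ T.D l S 0 := by
    refine mem_D_zero hS (fun E => ?_) (fun K₁ K₂ G hG h₁ h₂ n hn x hx => ?_)
      (fun G hG E hE n hn x hx => hoff E G hG.2.1 hE (fun hGF => hFS (hGF ▸ hG)) n hn x hx)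
    · by_cases h1 : E = K
      · rw [h1, hqK]
        exact radial_mem_localRT (by simp) _
      · rw [hq0 E h1]
        exact zero_mem _
    · by_cases hGF : G = K.1.erase a
      · subst hGF
        rw [Element.eq_of_boundary_face hd hopen hconv hΩ hG hF.2.2 h₁ h₂]
      · rw [hoff K₁ G hG h₁ hGF n hn x hx, hoff K₂ G hG h₂ hGF n hn x hx]
  have h0 := h q hmem
  rw [l2, Finset.sum_eq_single K (fun E _ hE => ?_) (fun hn => absurd (Finset.mem_univ _) hn)] at h0
  · change ∫ x in K.hull, evalAt (polyDiv (q K)) x * _ = 0 at h0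
    rw [hqK, hc, integral_polyDiv_radial_C] at h0
    have hd' : (d : ℝ) ≠ 0 := Nat.cast_ne_zero.2 hd.ne'
    simpa [hd', K.volume_hull_pos.ne'] using h0
  · change ∫ x in E.hull, evalAt (polyDiv (q E)) x * _ = 0
    rw [hq0 E hE, polyDiv_zero]
    simp

/-- The divergence maps `D_0^l` onto `W^l`, in the form of a uniqueness statement. -/
theorem eq_zero_of_orthogonal_div (hd : 0 < d) (hopen : IsOpen Ω) (hconv : Convex ℝ Ω)
    (hΩ : Ω.Nonempty) (hS : S ⊆ frontier Ω)
    (hS' : ∃ F ∈ T.facesIn (frontier Ω), F ∉ T.facesIn S) (hw : w ∈ T.X l)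
    (h : ∀ q ∈ T.D l S 0, l2 (div q) w = 0) : w = 0 := by
  choose c hc using eq_C_of_orthogonal hS hw h
  obtain ⟨F, hF, hFS⟩ := hS'
  obtain ⟨K₀, hK₀⟩ := exists_element_of_mem_facesIn hF
  have h0 := const_eq_zero_of_free_face hd hopen hconv hΩ hS h hc hF hFS hK₀
  funext K
  rw [hc K, eq_of_eq_of_shared_face hconv c
    (fun K K' F hF hK hK' => const_eq_of_shared_face hd hopen hconv hΩ hS h hc hF hK hK') K K₀, h0,
    map_zero]
  rfl

end InfSup

/-! ### Lifting of polynomial Neumann data -/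

section Lifting

theorem outerUnitNormal_unique {K : T.Element} {a : Pt d} (ha : a ∈ K.1)
    {ν ν' : Pt d} (hν : IsOuterUnitNormal Ω (K.1.erase a) ν)
    (hν' : IsOuterUnitNormal Ω (K.1.erase a) ν') {m : Pt d}
    (hm : m ∈ convexHull ℝ (K.1.erase a : Set (Pt d))) :
    ν = ν' ∧ inner ℝ (m - a) ν ≠ 0 := by
  classical
  have hsub : convexHull ℝ (K.1.erase a : Set (Pt d)) ⊆ closure Ω :=
    (convexHull_mono (Finset.coe_subset.2 (Finset.erase_subset _ _))).trans K.hull_subset_closure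
  have hzero : ∀ n, IsNormalTo (K.1.erase a) n → inner ℝ (a - m) n = 0 → n = 0 := by
    intro n hn h0
    refine K.eq_zero_of_isNormalTo fun b _ c _ => ?_
    rw [← sub_sub_sub_cancel_right b c m, inner_sub_left, K.inner_sub_of_isNormalTo ha hn hm b,
      K.inner_sub_of_isNormalTo ha hn hm c, h0]
    simp
  have hle : ∀ n, IsOuterUnitNormal Ω (K.1.erase a) n → inner ℝ (a - m) n < 0 := by
    intro n hn
    refine lt_of_le_of_ne (closure_minimal (t := {y | inner ℝ (y - m) n ≤ 0})
      (fun z hz => hn.2 m hm z hz) (isClosed_le (by fun_prop) continuous_const)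
      (K.hull_subset_closure (K.subset_hull ha))) fun h0 => ?_
    have h1 := hn.1
    rw [hzero n (hn.isNormalTo hsub) h0, norm_zero] at h1
    exact zero_ne_one h1
  have h1 := hle ν hν
  have h2 := hle ν' hν'
  set β := inner ℝ (a - m) ν with hβ
  set β' := inner ℝ (a - m) ν' with hβ'
  -- This combination is normal to the face and orthogonal to `a - m`, hence to all edges of `K`.
  -- Equal norms and the common sign of `β` and `β'` then identify the two normals.
  have hlin : β' • ν - β • ν' = 0 := by
    refine hzero _ (fun b hb c hc => ?_) ?_
    · rw [inner_sub_right, real_inner_smul_right, real_inner_smul_right,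
        hν.isNormalTo hsub b hb c hc, hν'.isNormalTo hsub b hb c hc]
      simp
    · rw [inner_sub_right, real_inner_smul_right, real_inner_smul_right, ← hβ, ← hβ']
      ring
  have heq := sub_eq_zero.1 hlin
  have hnorm := congrArg norm heq
  rw [norm_smul, norm_smul, hν.1, hν'.1, Real.norm_of_nonpos h2.le, Real.norm_of_nonpos h1.le]
    at hnorm
  have hββ : β' = β := by linarith
  refine ⟨?_, ?_⟩
  · rw [hββ] at heq
    exact smul_right_injective _ h1.ne heq
  · rw [← neg_sub, inner_neg_left, ← hβ]
    exact neg_ne_zero.2 h1.ne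

/-- On the face opposite `a`, `(x - a) · ν` is a nonzero constant; its inverse normalizes the radial
field to unit normal component. -/
theorem exists_normal_scale (hd : 0 < d) {K : T.Element} {a : Pt d} (ha : a ∈ K.1) :
    ∃ κ : ℝ, ∀ ν, IsOuterUnitNormal Ω (K.1.erase a) ν →
      ∀ x ∈ convexHull ℝ (K.1.erase a : Set (Pt d)), κ * inner ℝ (x - a) ν = 1 := by
  by_cases hex : ∃ ν, IsOuterUnitNormal Ω (K.1.erase a) ν
  · obtain ⟨ν₀, hν₀⟩ := hex
    obtain ⟨m, hm, -⟩ := K.exists_mem_face_interior hd ha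
    have hsub : convexHull ℝ (K.1.erase a : Set (Pt d)) ⊆ closure Ω :=
      (convexHull_mono (Finset.coe_subset.2 (Finset.erase_subset _ _))).trans K.hull_subset_closure
    refine ⟨(inner ℝ (m - a) ν₀)⁻¹, fun ν hν x hx => ?_⟩
    obtain ⟨rfl, hne⟩ := outerUnitNormal_unique ha hν₀ hν hm
    have h0 := inner_sub_eq_zero_of_isNormalTo (hν.isNormalTo hsub) hx hm
    have : x - a = (x - m) + (m - a) := by abel
    rw [this, inner_add_left, h0, zero_add, inv_mul_cancel₀ hne]
  -- Without an outer normal the condition is void, and any value serves.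
  · exact ⟨0, fun ν hν => absurd ⟨ν, hν⟩ hex⟩

/-- Polynomial Neumann data on boundary faces are normal traces of Raviart-Thomas fields. -/
theorem D_nonempty (hd : 0 < d) (hopen : IsOpen Ω) (hconv : Convex ℝ Ω) (hΩ : Ω.Nonempty)
    (hS : S ⊆ frontier Ω) {l : ℕ} {c : Finset (Pt d) → MvPolynomial (Fin d) ℝ}
    (hc : ∀ F ∈ T.facesIn S, (c F).totalDegree ≤ l) : (T.D l S c).Nonempty := by
  classical
  choose! κ hκ using fun (K : T.Element) (a : Pt d) (ha : a ∈ K.1) => exists_normal_scale hd ha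
  -- For each vertex `a`, the field `p (x - a)` has flux only through the face opposite `a`, so the
  -- data can be prescribed face by face.
  let p : T.Element → Pt d → MvPolynomial (Fin d) ℝ := fun K a =>
    if K.1.erase a ∈ T.facesIn S then κ K a • c (K.1.erase a) else 0
  have hp : ∀ K a, (p K a).totalDegree ≤ l := fun K a => by
    simp only [p]
    split_ifs with h
    · exact (MvPolynomial.totalDegree_smul_le _ _).trans (hc _ h)
    · simp
  have hcomp : ∀ (K : T.Element) (a : Pt d), a ∈ K.1 → ∀ n, IsNormalTo (K.1.erase a) n →
      ∀ x ∈ convexHull ℝ (K.1.erase a : Set (Pt d)),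
      comp (∑ b ∈ K.1, radial (p K b) b) n x = evalAt (p K a) x * inner ℝ (x - a) n := by
    intro K a ha n hn x hx
    rw [comp_sum, Finset.sum_eq_single a (fun b hb hba => Element.comp_radial_eq_zero
      (Finset.mem_erase.2 ⟨hba, hb⟩) hn hx _) (fun h => absurd ha h), comp_radial]
  refine ⟨fun K => ∑ a ∈ K.1, radial (p K a) a, ⟨fun K => ?_, fun K K' F hF hK hK' n hn x hx => ?_⟩,
    fun F hF K hK ν hν x hx => ?_⟩
  · exact Submodule.sum_mem (localRT d l) fun a _ => radial_mem_localRT (hp K a) a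
  · by_cases hFS : F ∈ T.facesIn S
    · rw [Element.eq_of_boundary_face hd hopen hconv hΩ hF (hull_subset_frontier hS hFS) hK hK']
    · have hz : ∀ E : T.Element, F ⊆ E.1 → comp (∑ a ∈ E.1, radial (p E a) a) n x = 0 := by
        intro E hE
        obtain ⟨a, ha, rfl⟩ := E.face_eq_erase hE hF
        rw [hcomp E a ha n hn x hx]
        simp only [p, if_neg hFS, evalAt_zero, zero_mul]
      rw [hz K hK, hz K' hK']
  · obtain ⟨a, ha, rfl⟩ := K.face_eq_erase hK hF.2.1
    rw [hcomp K a ha ν (hν.isNormalTo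
      ((hull_subset_frontier hS hF).trans frontier_subset_closure)) x hx]
    simp only [p, if_pos hF, evalAt_smul]
    rw [mul_right_comm, hκ K a ha ν hν x hx, one_mul]

end Lifting

/-! ### Definiteness of the primal stabilizer -/

section Coercivity

theorem meshSize_pos (hd : 0 < d) (hΩ : Ω.Nonempty) : 0 < T.meshSize := by
  obtain ⟨x, hx⟩ := hΩ
  have hx' := subset_closure hx
  rw [T.closure_eq_iUnion_hull] at hx'
  obtain ⟨K, -⟩ := Set.mem_iUnion.1 hx'
  refine lt_of_lt_of_le ?_ (le_ciSup (f := fun K : T.Element => Metric.diam K.hull)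
    (Set.finite_range _).bddAbove K)
  obtain ⟨a, ha, b, hb, hab⟩ := Finset.one_lt_card.1 (show 1 < K.1.card by rw [K.2.2]; omega)
  exact (dist_pos.2 hab).trans_le (Metric.dist_le_diam_of_mem K.isCompact_hull.isBounded
    (K.subset_hull ha) (K.subset_hull hb))

/-- A conforming function with vanishing gradient and vanishing trace on `S` is zero. -/
theorem eq_zero_of_grad_eq_zero (hd : 0 < d) (hconv : Convex ℝ Ω) (hfit : T.Fits S)
    (hSne : S.Nonempty) {k : ℕ} {v : T.Scalar} (hv : v ∈ T.V k S 0) (h : grad v = 0) : v = 0 := by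
  have hc : ∀ K, v K = MvPolynomial.C ((v K).coeff 0) := fun K =>
    eq_C_of_pderiv_eq_zero fun i => congrFun (congrFun h K) i
  obtain ⟨x, hx⟩ := hSne
  rw [hfit] at hx
  simp only [Set.mem_iUnion] at hx
  obtain ⟨F, hF, hxF⟩ := hx
  obtain ⟨K₀, hK₀⟩ := exists_element_of_mem_facesIn hF
  have h0 : (v K₀).coeff 0 = 0 := by
    have := hv.2 F hF K₀ hK₀ x hxF
    rw [hc K₀, evalAt_C] at this
    exact this
  have hface : ∀ (K K' : T.Element) (F : Finset (Pt d)), F.card = d → F ⊆ K.1 → F ⊆ K'.1 →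
      (v K).coeff 0 = (v K').coeff 0 := by
    intro K K' F hF hK hK'
    obtain ⟨b, hb⟩ := Finset.card_pos.1 (show 0 < F.card by rw [hF]; exact hd)
    have := hv.1.2 K K' b ⟨K.subset_hull (hK hb), K'.subset_hull (hK' hb)⟩
    rwa [hc K, hc K', evalAt_C, evalAt_C] at this
  funext K
  rw [hc K, eq_of_eq_of_shared_face hconv (fun K => (v K).coeff 0) hface K K₀, h0, map_zero]
  rfl

theorem tForm_self_ge {μ γ : ℝ} (hγ : 0 < γ) (k m : ℕ) (τ : Tikhonov) (hd : 0 < d)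
    (hΩ : Ω.Nonempty) (v : T.Scalar) :
    1 / 2 * γ * T.meshSize ^ (2 * k) * l2v (grad v) (grad v) ≤ T.tForm μ γ k m τ v v := by
  have h1 : 0 ≤ γ * T.meshSize ^ (2 * k) * l2v (grad v) (grad v) :=
    mul_nonneg (mul_nonneg hγ.le (pow_nonneg (meshSize_pos hd hΩ).le _)) (l2v_self_nonneg _)
  cases τ with
  | reduced => exact le_rfl
  | primalDual =>
    have h2 : 0 ≤ 1 / 2 * μ ^ 2 * T.meshSize ^ 2 * l2 (v - T.piW m v) (v - T.piW m v) :=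
      mul_nonneg (by positivity) (l2_self_nonneg _)
    simp only [tForm]
    linarith

/-- Both parts of `s` are nonnegative. If they vanish, the Tikhonov part gives `∇v = 0`, hence `v =
0` by the trace condition, and the remaining part reduces to `‖q‖²`. -/
theorem sForm_self_pos {A : Matrix (Fin d) (Fin d) ℝ} {μ γ : ℝ} (hγ : 0 < γ) {k m : ℕ}
    {τ : Tikhonov} (hd : 0 < d) (hΩ : Ω.Nonempty) (hconv : Convex ℝ Ω) (hfit : T.Fits S)
    (hSne : S.Nonempty) {v : T.Scalar} {q : T.VField} (hv : v ∈ T.V k S 0)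
    (hne : (v, q) ≠ 0) : 0 < T.sForm A (T.tForm μ γ k m τ) v q v q := by
  have h1 := l2v_self_nonneg (matMul A (grad v) - q)
  have h2 := T.tForm_self_ge (μ := μ) hγ k m τ hd hΩ v
  have h3 : 0 < 1 / 2 * γ * T.meshSize ^ (2 * k) := by
    have := pow_pos (meshSize_pos (T := T) hd hΩ) (2 * k)
    positivity
  have h4 := mul_nonneg h3.le (l2v_self_nonneg (grad v))
  rw [sForm]
  by_contra! hle
  have hg : l2v (grad v) (grad v) = 0 :=
    (mul_eq_zero.1 (le_antisymm (by linarith) h4)).resolve_left h3.ne'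
  have hv0 := eq_zero_of_grad_eq_zero hd hconv hfit hSne hv (l2v_self_eq_zero hg)
  have hm : matMul A (grad v) - q = 0 := l2v_self_eq_zero (by linarith)
  have hz : matMul A (grad v) = 0 := by
    rw [l2v_self_eq_zero hg]
    exact map_zero (matMulL T A)
  rw [hz, zero_sub, neg_eq_zero] at hm
  exact hne (by rw [hv0, hm]; rfl)

end Coercivity

end Mesh

end

/-! ### The discrete problem and its iteration as saddle point problems -/

section

variable {d : ℕ}

namespace Mesh

variable {Ω : Set (Pt d)} {T : Mesh Ω} {S : Set (Pt d)}

section Affine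

theorem sub_mem_VSub {k : ℕ} {b : Pt d → ℝ} {u v : T.Scalar} (hu : u ∈ T.V k S b)
    (hv : v ∈ T.V k S b) : u - v ∈ T.VSub k S :=
  ⟨⟨T.mem_XSub.1 (sub_mem (T.mem_XSub.2 hu.1.1) (T.mem_XSub.2 hv.1.1)),
    fun K K' x hx => by simp [hu.1.2 K K' x hx, hv.1.2 K K' x hx]⟩,
    fun F hF K hK x hx => by simp [hu.2 F hF K hK x hx, hv.2 F hF K hK x hx]⟩

theorem add_mem_V {k : ℕ} {b : Pt d → ℝ} {u v : T.Scalar} (hu : u ∈ T.V k S b)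
    (hv : v ∈ T.VSub k S) : u + v ∈ T.V k S b :=
  ⟨⟨T.mem_XSub.1 (add_mem (T.mem_XSub.2 hu.1.1) (T.mem_XSub.2 hv.1.1)),
    fun K K' x hx => by simp [hu.1.2 K K' x hx, hv.1.2 K K' x hx]⟩,
    fun F hF K hK x hx => by simp [hu.2 F hF K hK x hx, hv.2 F hF K hK x hx]⟩

theorem comp_sub (p q : Fin d → MvPolynomial (Fin d) ℝ) (n x : Pt d) :
    comp (p - q) n x = comp p n x - comp q n x := by
  simp [comp, sub_mul, Finset.sum_sub_distrib]

theorem sub_mem_DSub {l : ℕ} {c : Finset (Pt d) → MvPolynomial (Fin d) ℝ} {p q : T.VField}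
    (hp : p ∈ T.D l S c) (hq : q ∈ T.D l S c) : p - q ∈ T.DSub l S :=
  ⟨⟨fun K => (localRT d l).sub_mem (hp.1.1 K) (hq.1.1 K), fun K K' F hF h h' n hn x hx => by
      rw [Pi.sub_apply, Pi.sub_apply, comp_sub, comp_sub, hp.1.2 K K' F hF h h' n hn x hx,
        hq.1.2 K K' F hF h h' n hn x hx]⟩,
    fun F hF K hK ν hν x hx => by
      rw [Pi.sub_apply, comp_sub, hp.2 F hF K hK ν hν x hx, hq.2 F hF K hK ν hν x hx]
      simp⟩

theorem add_mem_D {l : ℕ} {c : Finset (Pt d) → MvPolynomial (Fin d) ℝ} {p q : T.VField}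
    (hp : p ∈ T.D l S c) (hq : q ∈ T.DSub l S) : p + q ∈ T.D l S c :=
  ⟨⟨fun K => (localRT d l).add_mem (hp.1.1 K) (hq.1.1 K), fun K K' F hF h h' n hn x hx => by
      rw [Pi.add_apply, Pi.add_apply, comp_add, comp_add, hp.1.2 K K' F hF h h' n hn x hx,
        hq.1.2 K K' F hF h h' n hn x hx]⟩,
    fun F hF K hK ν hν x hx => by
      rw [Pi.add_apply, comp_add, hp.2 F hF K hK ν hν x hx, hq.2 F hF K hK ν hν x hx]
      simp⟩

end Affine

section Discrete

variable (T) (k l : ℕ) (S) (A : Matrix (Fin d) (Fin d) ℝ) (μ γ : ℝ) (τ : Tikhonov)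

/-- The inclusion of the primal test space `V_0^k × D_0^l`. -/
def primalIncl : (T.VSub k S × T.DSub l S) →ₗ[ℝ] T.Scalar × T.VField :=
  LinearMap.prodMap (T.VSub k S).subtype (T.DSub l S).subtype

/-- The primal stabilizer on the test space. -/
def sDisc : (T.VSub k S × T.DSub l S) →ₗ[ℝ] (T.VSub k S × T.DSub l S) →ₗ[ℝ] ℝ :=
  (T.sBilin A μ γ k l τ).compl₁₂ (T.primalIncl S k l) (T.primalIncl S k l)

/-- The constraint form on the test space. -/
def bDisc : (T.VSub k S × T.DSub l S) →ₗ[ℝ] T.XSub l →ₗ[ℝ] ℝ :=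
  (T.bBilin μ).compl₁₂ (T.primalIncl S k l) (T.XSub l).subtype

/-- A dual stabilizer on `W^l`. -/
def cDisc (c : T.Scalar →ₗ[ℝ] T.Scalar →ₗ[ℝ] ℝ) : T.XSub l →ₗ[ℝ] T.XSub l →ₗ[ℝ] ℝ :=
  c.compl₁₂ (T.XSub l).subtype (T.XSub l).subtype

variable {T S k l A μ γ τ}

theorem sDisc_pos (hγ : 0 < γ) (hd : 0 < d) (hΩ : Ω.Nonempty) (hconv : Convex ℝ Ω)
    (hfit : T.Fits S) (hSne : S.Nonempty) (e : T.VSub k S × T.DSub l S) (he : e ≠ 0) :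
    0 < T.sDisc S k l A μ γ τ e e := by
  have hne : ((e.1 : T.Scalar), (e.2 : T.VField)) ≠ 0 := by
    rw [Ne, Prod.mk_eq_zero]
    rintro ⟨h1, h2⟩
    exact he (Prod.ext (Subtype.ext h1) (Subtype.ext h2))
  exact (sForm_self_pos hγ hd hΩ hconv hfit hSne e.1.2 hne).trans_eq
    (T.sBilin_apply A μ γ k l τ (T.primalIncl S k l e) (T.primalIncl S k l e)).symm

/-- Pairs with `v = 0` suffice: the divergence alone reaches all of `W^l`, whatever `μ` is. -/
theorem bDisc_nondegenerate (hd : 0 < d) (hopen : IsOpen Ω) (hconv : Convex ℝ Ω)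
    (hΩ : Ω.Nonempty) (hS : S ⊆ frontier Ω)
    (hS' : ∃ F ∈ T.facesIn (frontier Ω), F ∉ T.facesIn S) (w : T.XSub l)
    (h : ∀ e, T.bDisc S k l μ e w = 0) : w = 0 := by
  refine Subtype.ext (eq_zero_of_orthogonal_div hd hopen hconv hΩ hS hS' (T.mem_XSub.1 w.2)
    fun q hq => ?_)
  have h1 : T.bForm μ q (0 : T.Scalar) w = 0 := h (0, ⟨q, hq⟩)
  rwa [bForm, smul_zero, add_zero] at h1

variable {gh : Pt d → ℝ} {ψh : Finset (Pt d) → MvPolynomial (Fin d) ℝ}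

/-- Unique solvability of the discrete system for a positive semidefinite dual stabilizer. -/
theorem existsUnique_solves (c : T.Scalar →ₗ[ℝ] T.Scalar →ₗ[ℝ] ℝ) (R : T.Scalar →ₗ[ℝ] ℝ)
    (hs : ∀ e, e ≠ 0 → 0 < T.sDisc S k l A μ γ τ e e)
    (hb : ∀ w : T.XSub l, (∀ e, T.bDisc S k l μ e w = 0) → w = 0) (hc : ∀ w, 0 ≤ c w w)
    (hV : (T.V k S gh).Nonempty) (hD : (T.D l S ψh).Nonempty) :
    ∃! x, T.Solves k l l S gh ψh μ (T.sForm A (T.tForm μ γ k l τ)) (fun z w => c z w) R x := by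
  obtain ⟨u₀, hu₀⟩ := hV
  obtain ⟨p₀, hp₀⟩ := hD
  -- The inhomogeneous boundary data enter only through the shift by `(u₀, p₀)`, which moves to the
  -- right-hand side.
  set φ : Module.Dual ℝ (T.VSub k S × T.DSub l S) :=
    -(T.sBilin A μ γ k l τ (u₀, p₀) ∘ₗ T.primalIncl S k l) with hφ
  set ρ : Module.Dual ℝ (T.XSub l) := (R - T.bBilin μ (u₀, p₀)) ∘ₗ (T.XSub l).subtype with hρ
  have key : ∀ (e : T.VSub k S × T.DSub l S) (z : T.XSub l),
      T.Solves k l l S gh ψh μ (T.sForm A (T.tForm μ γ k l τ)) (fun z w => c z w) R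
        (u₀ + e.1, p₀ + e.2, z) ↔
      saddleMap (T.sDisc S k l A μ γ τ) (T.bDisc S k l μ) (T.cDisc l c) (e, z) = (φ, ρ) := by
    intro e z
    have hadd : ((u₀ + e.1, p₀ + e.2) : T.Scalar × T.VField) =
      (u₀, p₀) + T.primalIncl S k l e := rfl
    have hs' : ∀ (v : T.Scalar) (q : T.VField),
        T.sForm A (T.tForm μ γ k l τ) (u₀ + e.1) (p₀ + e.2) v q =
        T.sBilin A μ γ k l τ (u₀, p₀) (v, q) +
          T.sBilin A μ γ k l τ (T.primalIncl S k l e) (v, q) := fun v q => by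
      rw [← LinearMap.add_apply, ← map_add, ← hadd, sBilin_apply]
    have hb' : ∀ w, T.bForm μ (p₀ + e.2) (u₀ + e.1) w =
        T.bBilin μ (u₀, p₀) w + T.bBilin μ (T.primalIncl S k l e) w := fun w => by
      rw [← LinearMap.add_apply, ← map_add, ← hadd, bBilin_apply]
    rw [saddleMap_eq_iff]
    constructor
    · rintro ⟨-, -, -, h1, h2⟩
      refine ⟨fun v => ?_, fun w => ?_⟩
      · have := h1 v.1 v.1.2 v.2 v.2.2
        rw [hs'] at this
        change T.sBilin A μ γ k l τ (T.primalIncl S k l e) (v.1, v.2) + T.bForm μ v.2 v.1 z =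
          -T.sBilin A μ γ k l τ (u₀, p₀) (v.1, v.2)
        linarith
      · have := h2 w (T.mem_XSub.1 w.2)
        rw [hb'] at this
        change T.bBilin μ (T.primalIncl S k l e) w - c z w = R w - T.bBilin μ (u₀, p₀) w
        linarith
    · rintro ⟨h1, h2⟩
      refine ⟨add_mem_V hu₀ e.1.2, add_mem_D hp₀ e.2.2, T.mem_XSub.1 z.2, fun v hv q hq => ?_,
        fun w hw => ?_⟩
      · have : T.sBilin A μ γ k l τ (T.primalIncl S k l e) (v, q) + T.bForm μ q v z =
          -T.sBilin A μ γ k l τ (u₀, p₀) (v, q) := h1 (⟨v, hv⟩, ⟨q, hq⟩)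
        rw [hs']
        linarith
      · have : T.bBilin μ (T.primalIncl S k l e) w - c z w = R w - T.bBilin μ (u₀, p₀) w :=
          h2 ⟨w, T.mem_XSub.2 hw⟩
        rw [hb']
        linarith
  have hbij := saddleMap_bijective (c := T.cDisc l c) hs (fun w => hc w) hb
  obtain ⟨⟨e, z⟩, hez⟩ := hbij.2 (φ, ρ)
  refine ⟨(u₀ + e.1, p₀ + e.2, z), (key e z).2 hez, ?_⟩
  rintro ⟨u, p, y⟩ hx
  have hxu : u - u₀ ∈ T.VSub k S := sub_mem_VSub hx.1 hu₀
  have hxp : p - p₀ ∈ T.DSub l S := sub_mem_DSub hx.2.1 hp₀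
  have hxy : y ∈ T.XSub l := T.mem_XSub.2 hx.2.2.1
  have hx' : T.Solves k l l S gh ψh μ (T.sForm A (T.tForm μ γ k l τ)) (fun z w => c z w) R
      (u₀ + (⟨u - u₀, hxu⟩ : T.VSub k S), p₀ + (⟨p - p₀, hxp⟩ : T.DSub l S),
        (⟨y, hxy⟩ : T.XSub l)) := by
    simpa using hx
  have heq := hbij.1 (((key (⟨u - u₀, hxu⟩, ⟨p - p₀, hxp⟩) ⟨y, hxy⟩).1 hx').trans hez.symm)
  rw [Prod.mk.injEq] at heq
  obtain ⟨h1, h2⟩ := heq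
  rw [← h1, ← h2]
  simp

/-- Convergence of the defect correction iterates to the solution without dual stabilizer. -/
theorem tendsto_iterates (hs : ∀ e, e ≠ 0 → 0 < T.sDisc S k l A μ γ τ e e)
    (hb : ∀ w : T.XSub l, (∀ e, T.bDisc S k l μ e w = 0) → w = 0) {f : Pt d → ℝ}
    {u : T.Scalar} {p : T.VField} {z : T.Scalar}
    (h : T.SolvesFull k l l S gh ψh f A μ γ τ (u, p, z))
    {uκ : ℕ → T.Scalar} {pκ : ℕ → T.VField} {zκ : ℕ → T.Scalar} (h0 : zκ 0 = 0)
    (hstep : ∀ κ, T.SolvesStep k l l S gh ψh f A μ γ τ (zκ κ)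
      (uκ (κ + 1), pκ (κ + 1), zκ (κ + 1))) :
    Tendsto (fun κ => Mesh.normH1 (uκ κ - u)) atTop (𝓝 0) ∧
    Tendsto (fun κ => Mesh.normHdiv (pκ κ - p)) atTop (𝓝 0) ∧
    Tendsto (fun κ => Mesh.normL2 (zκ κ - z)) atTop (𝓝 0) := by
  have hz : ∀ n, zκ n ∈ T.XSub l := fun n => by
    cases n with
    | zero => rw [h0]; exact zero_mem _
    | succ n => exact T.mem_XSub.2 (hstep n).2.2.1
  -- The index is shifted: `e n` is the primal error of iterate `n + 1`, since `uκ 0` and `pκ 0` are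
  -- unconstrained and need not lie in the affine spaces.
  let e : ℕ → T.VSub k S × T.DSub l S := fun n =>
    (⟨uκ (n + 1) - u, sub_mem_VSub (hstep n).1 h.1⟩,
      ⟨pκ (n + 1) - p, sub_mem_DSub (hstep n).2.1 h.2.1⟩)
  let y : ℕ → T.XSub l := fun n => ⟨zκ n - z, sub_mem (hz n) (T.mem_XSub.2 h.2.2.1)⟩
  set c : T.XSub l →ₗ[ℝ] T.XSub l →ₗ[ℝ] ℝ := T.cDisc l ((1 / 2 : ℝ) • l2Bilin T) with hc
  have hcval : ∀ a b : T.XSub l, c a b = T.sStarL2 a b := fun a b => rfl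
  have hcpos : ∀ w, w ≠ 0 → 0 < c w w := fun w hw => by
    rw [hcval, sStarL2]
    have : 0 < l2 (w : T.Scalar) w := l2_self_pos fun h => hw (Subtype.ext h)
    linarith
  have hcsymm : ∀ a b, c a b = c b a := fun a b => by
    rw [hcval, hcval, sStarL2, sStarL2, l2_comm]
  have he : ∀ n, T.primalIncl S k l (e n) = (uκ (n + 1), pκ (n + 1)) - (u, p) := fun n => rfl
  have h1 : ∀ n v, T.sDisc S k l A μ γ τ (e n) v + T.bDisc S k l μ v (y (n + 1)) = 0 := by
    intro n v
    have e1 := (hstep n).2.2.2.1 v.1 v.1.2 v.2 v.2.2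
    have e2 := h.2.2.2.1 v.1 v.1.2 v.2 v.2.2
    change T.sBilin A μ γ k l τ (T.primalIncl S k l (e n)) (T.primalIncl S k l v) +
      T.bBilin μ (T.primalIncl S k l v) (zκ (n + 1) - z) = 0
    rw [he, map_sub, map_sub, LinearMap.sub_apply, sBilin_apply, sBilin_apply, bBilin_apply,
      bBilin_apply]
    change T.sForm A (T.tForm μ γ k l τ) (uκ (n + 1)) (pκ (n + 1)) v.1 v.2 -
      T.sForm A (T.tForm μ γ k l τ) u p v.1 v.2 +
      (T.bForm μ v.2 v.1 (zκ (n + 1)) - T.bForm μ v.2 v.1 z) = 0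
    simp only at e1 e2
    linarith
  have h2 : ∀ n w, T.bDisc S k l μ (e n) w - c (y (n + 1)) w = -c (y n) w := by
    intro n w
    have e1 := (hstep n).2.2.2.2 w (T.mem_XSub.1 w.2)
    have e2 := h.2.2.2.2 w (T.mem_XSub.1 w.2)
    have e3 : ∀ m, c (y m) w = T.sStarL2 (zκ m) w - T.sStarL2 z w := fun m => by
      have : l2Bilin T (zκ m - z) w = l2Bilin T (zκ m) w - l2Bilin T z w := by
        rw [map_sub, LinearMap.sub_apply]
      simp only [l2Bilin_apply] at this
      rw [hcval, sStarL2, sStarL2, sStarL2, ← mul_sub, ← this]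
    rw [e3, e3]
    change T.bBilin μ (T.primalIncl S k l (e n)) w - _ = _
    rw [he, map_sub, LinearMap.sub_apply, bBilin_apply, bBilin_apply]
    simp only at e1 e2 ⊢
    linarith
  have main := tendsto_saddle_iteration hs hcpos hcsymm hb e y h1 h2
  -- Each squared error norm is a bilinear form evaluated on the diagonal at the full error, so the
  -- abstract limit applies to it directly.
  let E := T.VSub k S × T.DSub l S
  let fu : (E × T.XSub l) →ₗ[ℝ] T.Scalar :=
    (T.VSub k S).subtype ∘ₗ LinearMap.fst ℝ _ _ ∘ₗ LinearMap.fst ℝ _ _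
  let fp : (E × T.XSub l) →ₗ[ℝ] T.VField :=
    (T.DSub l S).subtype ∘ₗ LinearMap.snd ℝ _ _ ∘ₗ LinearMap.fst ℝ _ _
  let fz : (E × T.XSub l) →ₗ[ℝ] T.Scalar := (T.XSub l).subtype ∘ₗ LinearMap.snd ℝ _ _
  have hsqrt : ∀ {g : ℕ → ℝ}, Tendsto g atTop (𝓝 0) → Tendsto (fun n => √(g n)) atTop (𝓝 0) :=
    fun hg => by simpa [Function.comp_def] using (Real.continuous_sqrt.tendsto 0).comp hg
  refine ⟨(tendsto_add_atTop_iff_nat 1).1 (hsqrt ?_), (tendsto_add_atTop_iff_nat 1).1 (hsqrt ?_),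
    (tendsto_add_atTop_iff_nat 1).1 (hsqrt ?_)⟩
  · exact main ((l2Bilin T).compl₁₂ fu fu + (l2vBilin T).compl₁₂ (gradL T ∘ₗ fu) (gradL T ∘ₗ fu))
  · exact main ((l2vBilin T).compl₁₂ fp fp + (l2Bilin T).compl₁₂ (divL T ∘ₗ fp) (divL T ∘ₗ fp))
  · exact main ((l2Bilin T).compl₁₂ fz fz)

end Discrete

end Mesh

end

end CauchyFEM

end

open CauchyFEM
theorem mainTheorem6 {d : ℕ} (hd : d = 2 ∨ d = 3)
    {Ω : Set (Pt d)} (hopen : IsOpen Ω) (hconv : Convex ℝ Ω) (hne : Ω.Nonempty)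
    (T : Mesh Ω)
    (S : Set (Pt d)) (hS : S ⊆ frontier Ω) (hfit : T.Fits S) (hSne : S.Nonempty)
    (hS' : ∃ F ∈ T.facesIn (frontier Ω), F ∉ T.facesIn S)
    (A : Matrix (Fin d) (Fin d) ℝ) (hA : A.PosDef) (μ : ℝ)
    (k l : ℕ) (hk : 1 ≤ k) (hl : l = k ∨ l = k - 1)
    (γT : ℝ) (hγ : 0 < γT) (τ : Mesh.Tikhonov)
    (f : Pt d → ℝ) (hf : MemLp f 2 (volume.restrict Ω))
    (g gh : Pt d → ℝ) (hg : ContinuousOn g S) (hgh : T.IsNodalInterpolant k S g gh)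
    (ψ : Pt d → ℝ) (hψ : MemLp ψ 2 (μHE[d - 1].restrict S))
    (ψh : Finset (Pt d) → MvPolynomial (Fin d) ℝ) (hψh : T.IsFaceProjection l S ψ ψh) :
    (∀ zOld ∈ T.X l, ∃! x, T.SolvesStep k l l S gh ψh f A μ γT τ zOld x) ∧
    ∃ (u : T.Scalar) (p : T.VField) (z : T.Scalar),
      T.SolvesFull k l l S gh ψh f A μ γT τ (u, p, z) ∧
      (∀ y, T.SolvesFull k l l S gh ψh f A μ γT τ y → y = (u, p, z)) ∧
      ∀ (uκ : ℕ → T.Scalar) (pκ : ℕ → T.VField) (zκ : ℕ → T.Scalar),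
        zκ 0 = 0 →
        (∀ κ, T.SolvesStep k l l S gh ψh f A μ γT τ (zκ κ) (uκ (κ + 1), pκ (κ + 1), zκ (κ + 1))) →
        Tendsto (fun κ => Mesh.normH1 (uκ κ - u)) atTop (𝓝 0) ∧
        Tendsto (fun κ => Mesh.normHdiv (pκ κ - p)) atTop (𝓝 0) ∧
        Tendsto (fun κ => Mesh.normL2 (zκ κ - z)) atTop (𝓝 0) := by
  have hd0 : 0 < d := by omega
  have hs := Mesh.sDisc_pos (T := T) (S := S) (k := k) (l := l) (A := A) (μ := μ) (τ := τ)
    hγ hd0 hne hconv hfit hSne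
  have hb := Mesh.bDisc_nondegenerate (T := T) (S := S) (k := k) (l := l) (μ := μ)
    hd0 hopen hconv hne hS hS'
  have hV : (T.V k S gh).Nonempty := by
    obtain ⟨⟨G, hG, hGt⟩, -⟩ := hgh
    exact ⟨G, hG, hGt⟩
  have hD : (T.D l S ψh).Nonempty :=
    Mesh.D_nonempty hd0 hopen hconv hne hS fun F hF => (hψh F hF).1
  refine ⟨fun zOld _ => ?_, ?_⟩
  · refine Mesh.existsUnique_solves ((1 / 2 : ℝ) • Mesh.l2Bilin T)
      (Mesh.loadL T hconv f hf - ((1 / 2 : ℝ) • Mesh.l2Bilin T) zOld) hs hb (fun w => ?_) hV hD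
    exact mul_nonneg (by norm_num) (Mesh.l2_self_nonneg w)
  · obtain ⟨⟨u, p, z⟩, hx, huniq⟩ := Mesh.existsUnique_solves (A := A) (γ := γT) (τ := τ)
      (0 : T.Scalar →ₗ[ℝ] T.Scalar →ₗ[ℝ] ℝ) (Mesh.loadL T hconv f hf) hs hb (fun _ => le_rfl) hV hD
    exact ⟨u, p, z, hx, huniq, fun uκ pκ zκ h0 hstep => Mesh.tendsto_iterates hs hb hx h0 hstep⟩
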